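/- Let $G$ be a non-compact, Hausdorff, locally compact, second countable topological group such that $G=\bigcup_{n\ge 1}K_n$, where $K_1\le K_2\le\cdots$ is an increasing sequence of compact open subgroups (if the sequence is strictly increasing, $G$ is automatically non-compact). Let $(p_n)_{n\ge1}$ be positive real numbers with $\sum_{n\ge 1} p_n=1$ such that, for some $C>0$, $p_n/p_{n+1}\le C$ for all $n$. Put $$\rho=\sum_{n=1}^\infty p_n\lambda_n,\qquad w=\sum_{n=1}^\infty p_n\,\rho^{*n},$$ where $\lambda_n$ is the normalized Haar measure of $K_n$, regarded as a probability measure on $G$, and $\rho^{*n}$ is the $n$-th convolution power of $\rho$. Let $H=L_2(G,w)$ be the real Hilbert space of (classes of) $w$-square-integrable functions. Then right translations of $G$ preserve the class of $w$-null sets, and $(S_g\xi)(h)=\xi(hg)$ defines a strongly continuous representation $g\mapsto S_g$ of $G$ by bounded linear operators on $H$. This representation is universal: for every ergodic, probability measure preserving, (essentially) free, measurable action $\mathbf X=(X,\mathcal B,\mu,\{T_g\}_{g\in G})$ of $G$ on a standard Borel probability space there exists an $\{S_g\}_{g\in G}$-invariant Borel probability measure $\nu$ on $H$ which is positive on every nonempty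 open subset of $H$ and such that the $G$-actions $\mathbf X$ and $(H,\mathrm{Borel}(H),\nu,\{S_g\}_{g\in G})$ are isomorphic, that is, there are $G$-invariant measurable sets $X_0\subseteq X$ and $H_0\subseteq H$ of full measure and a bimeasurable, measure preserving, $G$-equivariant bijection $X_0\to H_0$. -/

import Mathlib

open MeasureTheory
open scoped ENNReal

universe u v

/-- The normalized Haar measure of a compact subgroup `K` of `G`, seen as a probability measure
on `G` carried by `K`. -/
noncomputable def haarProb {G : Type*} [Group G] [TopologicalSpace G] [IsTopologicalGroup G]
    [MeasurableSpace G] [BorelSpace G] (K : Subgroup G) [CompactSpace K] : Measure G :=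
  (Measure.haarMeasure (⊤ : TopologicalSpace.PositiveCompacts K)).map (fun k : K => (k : G))

/-- The measure `ρ = ∑ pₙ λₙ`, where `λₙ` is the normalized Haar measure of the compact
subgroup `Kₙ`.  (Sequences are indexed from `0`.) -/
noncomputable def haarMixture {G : Type*} [Group G] [TopologicalSpace G] [IsTopologicalGroup G]
    [MeasurableSpace G] [BorelSpace G] (K : ℕ → Subgroup G) [∀ n, CompactSpace (K n)]
    (p : ℕ → ℝ) : Measure G :=
  Measure.sum fun n => ENNReal.ofReal (p n) • haarProb (K n)

/-- The `n`-th convolution power of a measure on a group. -/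
noncomputable def convPow {G : Type*} [Group G] [MeasurableSpace G] (ρ : Measure G) :
    ℕ → Measure G
  | 0 => Measure.dirac 1
  | n + 1 => (convPow ρ n).mconv ρ

/-- The measure `w = ∑_{n ≥ 1} pₙ ρ^{*n}`; as `p` is indexed from `0`, the coefficient `p n`
belongs to the convolution power with exponent `n + 1`. -/
noncomputable def walkWeight {G : Type*} [Group G] [MeasurableSpace G] (ρ : Measure G)
    (p : ℕ → ℝ) : Measure G :=
  Measure.sum fun n => ENNReal.ofReal (p n) • convPow ρ (n + 1)

/-- `S` is the right translation representation `(S_g ξ)(h) = ξ(h g)` of `G` on `L²(G, w)`.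
The first clause says that right translations preserve `w`-null sets, so that the formula in the
second clause does not depend on representatives; the third is strong continuity. -/
structure IsRightTranslationRep {G : Type*} [Group G] [TopologicalSpace G] [MeasurableSpace G]
    (w : Measure G) (S : G →* (Lp ℝ 2 w →L[ℝ] Lp ℝ 2 w)) : Prop where
  quasi : ∀ g : G, Measure.QuasiMeasurePreserving (fun h : G => h * g) w w
  apply_ae : ∀ (g : G) (ξ : Lp ℝ 2 w), ∀ᵐ h ∂w, S g ξ h = ξ (h * g)
  continuous : ∀ ξ : Lp ℝ 2 w, Continuous fun g : G => S g ξ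

/-- Isomorphism of the measure preserving actions `a` of `G` on `(X, μ)` and `b` of `G` on
`(Y, ν)`: an equivariant, measure preserving, bimeasurable bijection between invariant measurable
sets of full measure. -/
def IsomorphicActions {G X Y : Type*} [MeasurableSpace X] [MeasurableSpace Y]
    (a : G → X → X) (μ : Measure X) (b : G → Y → Y) (ν : Measure Y) : Prop :=
  ∃ (X₀ : Set X) (Y₀ : Set Y) (e : X₀ ≃ᵐ Y₀)
    (hX : ∀ g, ∀ x ∈ X₀, a g x ∈ X₀) (_ : ∀ g, ∀ y ∈ Y₀, b g y ∈ Y₀),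
    MeasurableSet X₀ ∧ MeasurableSet Y₀ ∧ μ X₀ᶜ = 0 ∧ ν Y₀ᶜ = 0 ∧
    MeasurePreserving e (μ.comap Subtype.val) (ν.comap Subtype.val) ∧
    ∀ (g : G) (x : X₀), (e ⟨a g x, hX g x x.2⟩ : Y) = b g (e x)

/-- A representation `S` of `G` on a Banach space `E` is universal if every ergodic, (essentially)
free, probability measure preserving action of `G` on a standard Borel space is isomorphic to the
action of `G` through `S` on `(E, ν)`, for some `S`-invariant Borel probability measure `ν` on `E`
that is positive on every nonempty open set. -/
def IsUniversalRep {G : Type*} [Group G] [MeasurableSpace G]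
    {E : Type*} [NormedAddCommGroup E] [NormedSpace ℝ E] [MeasurableSpace E] [BorelSpace E]
    (S : G →* (E →L[ℝ] E)) : Prop :=
  ∀ (X : Type v) [MeasurableSpace X] [StandardBorelSpace X] [MulAction G X] [MeasurableSMul₂ G X]
    (μ : Measure X) [IsProbabilityMeasure μ] [ErgodicSMul G X μ],
    (∀ᵐ x ∂μ, ∀ g : G, g • x = x → g = 1) →
    ∃ ν : Measure E, IsProbabilityMeasure ν ∧
      (∀ g : G, MeasurePreserving (S g) ν ν) ∧
      (∀ U : Set E, IsOpen U → U.Nonempty → 0 < ν U) ∧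
      IsomorphicActions (fun (g : G) (x : X) => g • x) μ (fun (g : G) (ξ : E) => S g ξ) ν

/-! ### Domination of the right translates of `w` by multiples of `w`. -/

section Walk

open Measure

/-! For measurable `f` on `X`, send `x` to its orbit function `g ↦ f (g • x)` in `L²(G, w)`. This
map intertwines the action with `S`, so it carries `μ` to an `S`-invariant measure, and the two
actions are isomorphic once the map is injective on an invariant conull set. A bounded injective
`f₀` achieves injectivity; the difficulty is to get full support as well.

The operators `S g` exist because `w` dominates its right translates up to a constant, uniformly for
`g` in each `K n` (`exists_map_mul_right_walkWeight_le`); this uniformity also gives strong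
continuity.

For full support, each ball of a countable family must be hit with positive probability. By freeness
and noncompactness, a compact piece `K • x₀` of an orbit is null, so `f` can be rewritten near it to
imitate any bounded continuous `u` on `K`, at arbitrarily small cost
(`exists_modification_on_tower`). As `w` is almost carried by a large `K n`, the orbit functions of
points near `x₀` then lie near `u` in `L²(w)`, and this survives small `L²` perturbations of `f`
(`exists_stable_modification`). Handling the balls one after another with rapidly decreasing errors
gives a limit `f` (`exists_limit_of_stable_modifications`).

Injectivity survives because `f₀` is irrational-valued and all new values are rational: an
irrational value of `f` is a value of `f₀`. Such values occur with positive probability, so by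
ergodicity almost every orbit function has some, and each identifies the point
(`IsRightTranslationRep.isUniversalRep`). -/

theorem isProbabilityMeasure_sum_ofReal_smul {α : Type*} [MeasurableSpace α] {p : ℕ → ℝ}
    (hp : ∀ n, 0 < p n) (hs : HasSum p 1) (m : ℕ → Measure α) [∀ n, IsProbabilityMeasure (m n)] :
    IsProbabilityMeasure (Measure.sum fun n => ENNReal.ofReal (p n) • m n) := by
  refine ⟨?_⟩
  simp only [sum_apply _ MeasurableSet.univ, Measure.smul_apply, measure_univ, smul_eq_mul, mul_one]
  rw [← ENNReal.ofReal_tsum_of_nonneg (fun n => (hp n).le) hs.summable, hs.tsum_eq,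
    ENNReal.ofReal_one]

theorem isProbabilityMeasure_convPow {G : Type*} [Group G] [MeasurableSpace G]
    [MeasurableMul₂ G] (ρ : Measure G) [IsProbabilityMeasure ρ] :
    ∀ n, IsProbabilityMeasure (convPow ρ n)
  | 0 => by rw [convPow]; infer_instance
  | n + 1 => by
    have := isProbabilityMeasure_convPow ρ n
    rw [convPow]; infer_instance

/-- Right translation acts on the last convolution factor only, so the constant is unchanged. -/
theorem map_mul_right_mconv_le {G : Type*} [Group G] [MeasurableSpace G]
    [MeasurableMul₂ G] {μ ρ : Measure G} [SFinite μ] [SFinite ρ]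
    {g : G} {c : ℝ≥0∞} (h : ρ.map (· * g) ≤ c • ρ) :
    (μ.mconv ρ).map (· * g) ≤ c • μ.mconv ρ := by
  refine Measure.le_iff.2 fun s hs => ?_
  rw [← lintegral_indicator_one hs, lintegral_map (measurable_one.indicator hs)
    (measurable_mul_const g), Measure.smul_apply, ← lintegral_indicator_one hs]
  have hmi : Measurable (s.indicator (1 : G → ℝ≥0∞)) := measurable_one.indicator hs
  rw [lintegral_mconv (f := fun z => s.indicator (1 : G → ℝ≥0∞) (z * g))
    (hmi.comp (measurable_mul_const g)), lintegral_mconv hmi, smul_eq_mul,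
    ← lintegral_const_mul _ (Measurable.lintegral_prod_right' (f := fun z : G × G =>
      s.indicator (1 : G → ℝ≥0∞) (z.1 * z.2)) (hmi.comp measurable_mul))]
  refine lintegral_mono fun x => ?_
  have hx : Measurable fun y => s.indicator (1 : G → ℝ≥0∞) (x * y) :=
    hmi.comp (measurable_const_mul x)
  calc ∫⁻ y, s.indicator (1 : G → ℝ≥0∞) (x * y * g) ∂ρ
      = ∫⁻ y, s.indicator (1 : G → ℝ≥0∞) (x * y) ∂(ρ.map (· * g)) := by
        rw [lintegral_map hx (measurable_mul_const g)]
        simp only [mul_assoc]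
    _ ≤ ∫⁻ y, s.indicator (1 : G → ℝ≥0∞) (x * y) ∂(c • ρ) := lintegral_mono' h le_rfl
    _ = _ := by rw [lintegral_smul_measure, smul_eq_mul]

variable {G : Type*} [Group G] [TopologicalSpace G] [IsTopologicalGroup G]
  [MeasurableSpace G] [BorelSpace G]

instance isProbabilityMeasure_haarProb (K : Subgroup G) [CompactSpace K] :
    IsProbabilityMeasure (haarProb K) := by
  have : IsProbabilityMeasure (haarMeasure (⊤ : TopologicalSpace.PositiveCompacts K)) :=
    ⟨by simpa using haarMeasure_self (K₀ := (⊤ : TopologicalSpace.PositiveCompacts K))⟩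
  exact isProbabilityMeasure_map measurable_subtype_coe.aemeasurable

theorem map_mul_left_haarProb (K : Subgroup G) [CompactSpace K] {g : G} (hg : g ∈ K) :
    (haarProb K).map (g * ·) = haarProb K := by
  rw [haarProb, map_map (measurable_const_mul g) measurable_subtype_coe]
  have : (g * ·) ∘ (fun k : K => (k : G)) = (fun k : K => (k : G)) ∘ ((⟨g, hg⟩ : K) * ·) := rfl
  rw [this, ← map_map measurable_subtype_coe (measurable_const_mul _), map_mul_left_eq_self]

/-- A right translate is still left invariant, hence a multiple of Haar measure; total mass forces
the factor 1. -/
theorem map_mul_right_haarMeasure_top {K : Type*} [Group K] [TopologicalSpace K]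
    [IsTopologicalGroup K] [CompactSpace K] [MeasurableSpace K] [BorelSpace K]
    [SecondCountableTopology K] (g : K) :
    (haarMeasure (⊤ : TopologicalSpace.PositiveCompacts K)).map (· * g) = haarMeasure ⊤ := by
  have h := haarMeasure_unique ((haarMeasure (⊤ : TopologicalSpace.PositiveCompacts K)).map (· * g))
    ⊤
  rw [h, map_apply (measurable_mul_const g) (by simp)]
  have := haarMeasure_self (K₀ := (⊤ : TopologicalSpace.PositiveCompacts K))
  simp_all

theorem map_mul_right_haarProb [SecondCountableTopology G] (K : Subgroup G) [CompactSpace K]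
    {g : G} (hg : g ∈ K) :
    (haarProb K).map (· * g) = haarProb K := by
  have : SecondCountableTopology K := TopologicalSpace.Subtype.secondCountableTopology _
  rw [haarProb, map_map (measurable_mul_const g) measurable_subtype_coe]
  have : (· * g) ∘ (fun k : K => (k : G)) = (fun k : K => (k : G)) ∘ (· * (⟨g, hg⟩ : K)) := rfl
  rw [this, ← map_map measurable_subtype_coe (measurable_mul_const _),
    map_mul_right_haarMeasure_top]

/-- `K` is open, so it has positive mass `a` for the Haar measure of `L`, whose restriction to `K`
is left `K`-invariant and hence `a` times the Haar probability of `K`. This gives `c = a⁻¹`. -/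
theorem exists_haarProb_le_smul [SecondCountableTopology G] {K L : Subgroup G} [CompactSpace K]
    [CompactSpace L] (hK : IsOpen (K : Set G)) (h : K ≤ L) :
    ∃ c : ℝ≥0∞, c ≠ ∞ ∧ haarProb K ≤ c • haarProb L := by
  have hemb : MeasurableEmbedding (fun k : K => (k : G)) :=
    MeasurableEmbedding.subtype_coe hK.measurableSet
  set m := (haarProb L).comap (fun k : K => (k : G)) with hm
  have : SecondCountableTopology K := TopologicalSpace.Subtype.secondCountableTopology _
  have : IsFiniteMeasure m := ⟨by rw [hm, hemb.comap_apply]; exact measure_lt_top _ _⟩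
  have : IsMulLeftInvariant m := by
    refine ⟨fun g => ?_⟩
    refine Measure.ext fun s hs => ?_
    have hg : (g : G) ∈ L := h g.2
    rw [map_apply (measurable_const_mul g) hs, hm, hemb.comap_apply, hemb.comap_apply]
    conv_rhs => rw [← map_mul_left_haarProb L hg,
      map_apply (measurable_const_mul _) (hemb.measurableSet_image.2 hs)]
    congr 1
    ext x
    constructor
    · rintro ⟨y, hy, rfl⟩
      exact ⟨g * y, hy, rfl⟩
    · rintro ⟨y, hy, hxy⟩
      refine ⟨g⁻¹ * y, by simpa using hy, ?_⟩
      simp only [Subgroup.coe_mul, InvMemClass.coe_inv] at *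
      rw [hxy]; group
  have hu := haarMeasure_unique m ⊤
  set a := m (⊤ : TopologicalSpace.PositiveCompacts K) with ha
  have ha0 : a ≠ 0 := by
    have : a = haarProb L (K : Set G) := by
      rw [ha, hm, hemb.comap_apply]; simp
    rw [this, haarProb, map_apply measurable_subtype_coe hK.measurableSet]
    exact ((hK.preimage continuous_subtype_val).measure_pos _ ⟨1, K.one_mem⟩).ne'
  refine ⟨a⁻¹, ENNReal.inv_ne_top.2 ha0, ?_⟩
  have hat : a ≠ ∞ := measure_ne_top _ _
  have h1 : haarMeasure (⊤ : TopologicalSpace.PositiveCompacts K) = a⁻¹ • m := by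
    rw [hu, smul_smul, ENNReal.inv_mul_cancel ha0 hat, one_smul]
  rw [haarProb, h1, Measure.map_smul, hm, hemb.map_comap]
  gcongr
  exact restrict_le_self

theorem isProbabilityMeasure_walkWeight [SecondCountableTopology G] (K : ℕ → Subgroup G)
    [∀ n, CompactSpace (K n)] {p : ℕ → ℝ} (hp : ∀ n, 0 < p n) (hs : HasSum p 1) :
    IsProbabilityMeasure (walkWeight (haarMixture K p) p) := by
  have : IsProbabilityMeasure (haarMixture K p) := isProbabilityMeasure_sum_ofReal_smul hp hs _
  have := isProbabilityMeasure_convPow (haarMixture K p)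
  exact isProbabilityMeasure_sum_ofReal_smul hp hs _

/-- Translation by `g ∈ K n` fixes the terms of index at least `n`. Each of the finitely many
earlier ones is dominated by a multiple of `haarProb (K n)`, which is itself at most `(p n)⁻¹` times
the mixture. -/
theorem exists_map_mul_right_haarMixture_le [SecondCountableTopology G] {K : ℕ → Subgroup G}
    [∀ n, CompactSpace (K n)] (hK_open : ∀ n, IsOpen (K n : Set G)) (hK_mono : Monotone K)
    {p : ℕ → ℝ} (hp : ∀ n, 0 < p n) (n : ℕ) :
    ∃ c : ℝ≥0∞, c ≠ ∞ ∧ ∀ g ∈ K n, (haarMixture K p).map (· * g) ≤ c • haarMixture K p := by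
  have hd : ∀ k, ∃ c : ℝ≥0∞, c ≠ ∞ ∧ (k ≤ n → haarProb (K k) ≤ c • haarProb (K n)) := by
    intro k
    by_cases hk : k ≤ n
    · obtain ⟨c, hc, h⟩ := exists_haarProb_le_smul (hK_open k) (hK_mono hk)
      exact ⟨c, hc, fun _ => h⟩
    · exact ⟨0, by simp, fun h => absurd h hk⟩
  choose c hc hcle using hd
  set a : ℕ → ℝ≥0∞ := fun k => ENNReal.ofReal (p k)
  have ha0 : a n ≠ 0 := by simpa [a] using hp n
  have hat : ∀ k, a k ≠ ∞ := fun k => ENNReal.ofReal_ne_top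
  refine ⟨1 + (∑ k ∈ Finset.range n, a k * c k) * (a n)⁻¹, ?_, fun g hg => ?_⟩
  · refine ENNReal.add_ne_top.2 ⟨by simp, ENNReal.mul_ne_top ?_ (ENNReal.inv_ne_top.2 ha0)⟩
    exact ENNReal.sum_ne_top.2 fun k _ => ENNReal.mul_ne_top (hat k) (hc k)
  refine Measure.le_iff.2 fun s hs => ?_
  have hms : MeasurableSet ((· * g) ⁻¹' s) := measurable_mul_const g hs
  have hlarge : ∀ k, n ≤ k → haarProb (K k) ((· * g) ⁻¹' s) = haarProb (K k) s := by
    intro k hk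
    rw [← map_apply (measurable_mul_const g) hs, map_mul_right_haarProb (K k) (hK_mono hk hg)]
  have hsmall : ∀ k, k < n → haarProb (K k) ((· * g) ⁻¹' s) ≤ c k * haarProb (K n) s := by
    intro k hk
    refine (hcle k hk.le _).trans ?_
    rw [Measure.smul_apply, smul_eq_mul, hlarge n le_rfl]
  rw [map_apply (measurable_mul_const g) hs, Measure.smul_apply, haarMixture, sum_apply _ hms,
    sum_apply _ hs, smul_eq_mul, add_mul, one_mul, add_comm,
    ← ENNReal.summable.sum_add_tsum_nat_add' (k := n)]
  simp only [Measure.smul_apply, smul_eq_mul]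
  refine add_le_add ?_ ?_
  · rw [Finset.sum_mul, Finset.sum_mul]
    refine Finset.sum_le_sum fun k hk => ?_
    have : a n * haarProb (K n) s ≤ ∑' i, ENNReal.ofReal (p i) * haarProb (K i) s :=
      ENNReal.le_tsum n
    calc a k * haarProb (K k) ((· * g) ⁻¹' s) ≤ a k * (c k * haarProb (K n) s) := by
          gcongr; exact hsmall k (Finset.mem_range.1 hk)
      _ = a k * c k * (a n)⁻¹ * (a n * haarProb (K n) s) := by
          rw [mul_assoc (a k * c k), ← mul_assoc (a n)⁻¹, ENNReal.inv_mul_cancel ha0 (hat n),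
            one_mul, mul_assoc]
      _ ≤ _ := by gcongr
  · rw [← ENNReal.summable.sum_add_tsum_nat_add' (k := n)
      (f := fun i => ENNReal.ofReal (p i) * haarProb (K i) s)]
    refine le_trans (le_of_eq ?_) le_add_self
    exact tsum_congr fun k => by rw [hlarge _ (Nat.le_add_left n k)]

theorem exists_map_mul_right_walkWeight_le [SecondCountableTopology G] {K : ℕ → Subgroup G}
    [∀ n, CompactSpace (K n)] (hK_open : ∀ n, IsOpen (K n : Set G)) (hK_mono : Monotone K)
    {p : ℕ → ℝ} (hp : ∀ n, 0 < p n) (hs : HasSum p 1) (n : ℕ) :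
    ∃ c : ℝ≥0∞, c ≠ ∞ ∧ ∀ g ∈ K n, (walkWeight (haarMixture K p) p).map (· * g) ≤
      c • walkWeight (haarMixture K p) p := by
  obtain ⟨c, hc, h⟩ := exists_map_mul_right_haarMixture_le hK_open hK_mono hp n
  have : IsProbabilityMeasure (haarMixture K p) := isProbabilityMeasure_sum_ofReal_smul hp hs _
  have := isProbabilityMeasure_convPow (haarMixture K p)
  refine ⟨c, hc, fun g hg => Measure.le_iff.2 fun s hs => ?_⟩
  rw [map_apply (measurable_mul_const g) hs, Measure.smul_apply, walkWeight,
    sum_apply _ (measurable_mul_const g hs), sum_apply _ hs, smul_eq_mul, ← ENNReal.tsum_mul_left]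
  refine ENNReal.tsum_le_tsum fun k => ?_
  -- Only exponents `k + 1 ≥ 1` occur in `w`, so every power has a last factor `ρ` to absorb the
  -- translation.
  have hk := map_mul_right_mconv_le (μ := convPow (haarMixture K p) k) (h g hg) s
  rw [map_apply (measurable_mul_const g) hs] at hk
  simp only [Measure.smul_apply, smul_eq_mul] at hk ⊢
  rw [mul_left_comm]
  gcongr
  exact hk

end Walk

/-! ### The right translation representation and its strong continuity. -/

section Translation

open Measure Filter Topology

/-- The square of the `L²` seminorm is the integral of the squared norm. -/
theorem eLpNorm_two_sq {α E : Type*} [MeasurableSpace α] [NormedAddCommGroup E] (f : α → E)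
    (μ : Measure α) : eLpNorm f 2 μ ^ 2 = ∫⁻ x, ‖f x‖ₑ ^ 2 ∂μ := by
  simpa using eLpNorm_nnreal_pow_eq_lintegral (f := f) (μ := μ) (p := 2) (by simp)

theorem exists_boundedContinuous_norm_toLp_sub_lt {G : Type*} [TopologicalSpace G]
    [MeasurableSpace G] [BorelSpace G] [SecondCountableTopology G] [T2Space G]
    [LocallyCompactSpace G] {w : Measure G} [IsFiniteMeasure w] (ξ : Lp ℝ 2 w) {ε : ℝ} (hε : 0 < ε) :
    ∃ (u : BoundedContinuousFunction G ℝ) (hu : MemLp u 2 w), ‖hu.toLp u - ξ‖ < ε := by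
  obtain ⟨u, hle, hu⟩ := (Lp.memLp ξ).exists_boundedContinuous_eLpNorm_sub_le (by simp)
    (ε := ENNReal.ofReal (ε / 2)) (by simpa using hε)
  refine ⟨u, hu, ?_⟩
  have hξ : (Lp.memLp ξ).toLp ξ = ξ := Lp.toLp_coeFn ξ _
  rw [norm_sub_rev, ← hξ, ← MemLp.toLp_sub, Lp.norm_toLp]
  refine (ENNReal.toReal_mono (by simp) hle).trans_lt ?_
  rw [ENNReal.toReal_ofReal (by positivity)]
  linarith

variable {G : Type*} [Group G] [MeasurableSpace G] [MeasurableMul G] {w : Measure G}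

/-- The operator is the identity from `L²(w)` to `L²` of the translated measure, bounded by
domination, followed by the isometry of composing with the translation. -/
theorem exists_translation_continuousLinearMap {g : G} {c : ℝ≥0∞} (hc : c ≠ ∞)
    (h : w.map (· * g) ≤ c • w) :
    ∃ T : Lp ℝ 2 w →L[ℝ] Lp ℝ 2 w, (∀ ξ, ∀ᵐ x ∂w, T ξ x = ξ (x * g)) ∧
      ‖T‖ ≤ c.toReal ^ (1 / 2 : ℝ≥0∞).toReal := by
  have hmp : MeasurePreserving (· * g) w (w.map (· * g)) :=
    ⟨measurable_mul_const g, rfl⟩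
  let A : Lp ℝ 2 w →L[ℝ] Lp ℝ 2 (w.map (· * g)) := Lp.LpToLpOfMeasureLeSMul hc h
  let B : Lp ℝ 2 (w.map (· * g)) →ₗᵢ[ℝ] Lp ℝ 2 w := Lp.compMeasurePreservingₗᵢ ℝ (· * g) hmp
  refine ⟨B.toContinuousLinearMap.comp A, fun ξ => ?_, ?_⟩
  · have h1 : B (A ξ) =ᵐ[w] A ξ ∘ (· * g) := Lp.coeFn_compMeasurePreserving (A ξ) hmp
    have h2 := hmp.quasiMeasurePreserving.ae_eq_comp (Lp.coeFn_LpToLpOfMeasureLeSMul hc h ξ)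
    filter_upwards [h1, h2] with x hx1 hx2
    exact hx1.trans hx2
  · refine ContinuousLinearMap.opNorm_le_bound _ (by positivity) fun ξ => ?_
    refine (B.norm_map _).trans_le ?_
    exact A.le_of_opNorm_le (Lp.norm_LpToLpOfMeasureLeSMul_le hc h) ξ

theorem quasiMeasurePreserving_mul_right {g : G} {c : ℝ≥0∞}
    (h : w.map (· * g) ≤ c • w) : QuasiMeasurePreserving (· * g) w w :=
  ⟨measurable_mul_const g, Measure.absolutelyContinuous_of_le_smul h⟩

theorem exists_translationRep
    (hw : ∀ g : G, ∃ c : ℝ≥0∞, c ≠ ∞ ∧ w.map (· * g) ≤ c • w) :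
    ∃ S : G →* (Lp ℝ 2 w →L[ℝ] Lp ℝ 2 w), ∀ g ξ, ∀ᵐ x ∂w, S g ξ x = ξ (x * g) := by
  choose c hc h using hw
  choose T hT _ using fun g => exists_translation_continuousLinearMap (hc g) (h g)
  refine ⟨⟨⟨T, ?_⟩, ?_⟩, hT⟩
  · ext1 ξ
    refine Lp.ext ?_
    filter_upwards [hT 1 ξ] with x hx
    simpa using hx
  · intro a b
    ext1 ξ
    refine Lp.ext ?_
    filter_upwards [hT (a * b) ξ, hT a (T b ξ),
      (quasiMeasurePreserving_mul_right (h a)).ae (hT b ξ)] with x h1 h2 h3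
    rw [h1, mul_apply_eq_comp, h2, h3, mul_assoc]

theorem norm_translation_le {S : G →* (Lp ℝ 2 w →L[ℝ] Lp ℝ 2 w)}
    (hS : ∀ g ξ, ∀ᵐ x ∂w, S g ξ x = ξ (x * g)) {g : G} {c : ℝ≥0∞} (hc : c ≠ ∞)
    (h : w.map (· * g) ≤ c • w) : ‖S g‖ ≤ c.toReal ^ (1 / 2 : ℝ≥0∞).toReal := by
  obtain ⟨T, hT, hn⟩ := exists_translation_continuousLinearMap hc h
  have : S g = T := by
    ext1 ξ
    refine Lp.ext ?_
    filter_upwards [hS g ξ, hT ξ] with x h1 h2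
    rw [h1, h2]
  rwa [this]

theorem continuous_translation_boundedContinuous {G : Type*} [Group G]
    [MeasurableSpace G] {w : Measure G} [TopologicalSpace G] [IsTopologicalGroup G]
    [BorelSpace G] [FirstCountableTopology G] [IsFiniteMeasure w]
    {S : G →* (Lp ℝ 2 w →L[ℝ] Lp ℝ 2 w)}
    (hS : ∀ g ξ, ∀ᵐ x ∂w, S g ξ x = ξ (x * g))
    (hq : ∀ g : G, QuasiMeasurePreserving (· * g) w w) (u : BoundedContinuousFunction G ℝ)
    (hu : MemLp u 2 w) :
    Continuous fun g => S g (hu.toLp u) := by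
  refine continuous_iff_continuousAt.2 fun g₀ => ?_
  have hval : ∀ g, S g (hu.toLp u) =ᵐ[w] fun x => u (x * g) := by
    intro g
    filter_upwards [hS g (hu.toLp u), (hq g).ae hu.coeFn_toLp] with x h1 h2
    rw [h1, h2]
  rw [ContinuousAt, Lp.tendsto_Lp_iff_tendsto_eLpNorm']
  have hsq : Tendsto (fun g => eLpNorm (fun x => u (x * g) - u (x * g₀)) 2 w ^ 2) (𝓝 g₀)
      (𝓝 0) := by
    simp only [eLpNorm_two_sq]
    have h0 : ∫⁻ x, ‖u (x * g₀) - u (x * g₀)‖ₑ ^ 2 ∂w = 0 := by simp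
    rw [← h0]
    refine tendsto_lintegral_filter_of_dominated_convergence
      (fun _ => ENNReal.ofReal (2 * ‖u‖) ^ 2) (Eventually.of_forall fun g => ?_)
      (Eventually.of_forall fun g => Eventually.of_forall fun x => ?_) ?_
      (Eventually.of_forall fun x => ?_)
    · exact ((u.continuous.comp (continuous_mul_const g)).sub
        (u.continuous.comp (continuous_mul_const g₀))).enorm.measurable.pow_const 2
    · rw [← ofReal_norm]
      gcongr
      rw [← dist_eq_norm]
      exact u.dist_le_two_norm _ _
    · rw [lintegral_const]
      exact ENNReal.mul_ne_top (by finiteness) (measure_ne_top _ _)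
    · refine Continuous.tendsto (f := fun g => ‖u (x * g) - u (x * g₀)‖ₑ ^ 2) ?_ g₀
      fun_prop
  have h2 : Tendsto (fun g => eLpNorm (fun x => u (x * g) - u (x * g₀)) 2 w) (𝓝 g₀) (𝓝 0) := by
    have := (ENNReal.continuous_rpow_const (y := (2 : ℝ)⁻¹)).tendsto 0 |>.comp hsq
    simp only [ENNReal.zero_rpow_of_pos (show (0 : ℝ) < 2⁻¹ by norm_num)] at this
    refine this.congr fun g => ?_
    simp only [Function.comp]
    rw [← ENNReal.rpow_natCast, ← ENNReal.rpow_mul]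
    simp
  refine h2.congr fun g => (eLpNorm_congr_ae ?_).symm
  exact (hval g).sub (hval g₀)

/-- Locally bounded operator norms reduce strong continuity to a dense set of vectors; for bounded
continuous functions it is dominated convergence. -/
theorem isRightTranslationRep_of_le {G : Type*} [Group G]
    [MeasurableSpace G] {w : Measure G} [TopologicalSpace G] [IsTopologicalGroup G]
    [BorelSpace G] [SecondCountableTopology G] [T2Space G] [LocallyCompactSpace G]
    [IsFiniteMeasure w] {S : G →* (Lp ℝ 2 w →L[ℝ] Lp ℝ 2 w)}
    (hS : ∀ g ξ, ∀ᵐ x ∂w, S g ξ x = ξ (x * g))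
    (hw : ∀ g₀ : G, ∃ t ∈ 𝓝 g₀, ∃ c : ℝ≥0∞, c ≠ ∞ ∧ ∀ g ∈ t, w.map (· * g) ≤ c • w) :
    IsRightTranslationRep w S := by
  have hq : ∀ g : G, QuasiMeasurePreserving (· * g) w w := by
    intro g
    obtain ⟨t, ht, c, -, h⟩ := hw g
    exact quasiMeasurePreserving_mul_right (h g (mem_of_mem_nhds ht))
  refine ⟨hq, hS, fun ξ => ?_⟩
  refine continuous_of_locally_uniform_approx_of_continuousAt fun g₀ U hU => ?_
  obtain ⟨ε, hε, hεU⟩ := Metric.mem_uniformity_dist.1 hU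
  obtain ⟨t, ht, c, hc, h⟩ := hw g₀
  set C := c.toReal ^ (1 / 2 : ℝ≥0∞).toReal with hC
  have hC0 : 0 ≤ C := by positivity
  obtain ⟨u, hu, hlt⟩ := exists_boundedContinuous_norm_toLp_sub_lt ξ
    (show 0 < ε / (C + 1) by positivity)
  refine ⟨t, ht, fun g => S g (hu.toLp u),
    (continuous_translation_boundedContinuous hS hq u hu).continuousAt, fun g hg => hεU ?_⟩
  rw [dist_comm, dist_eq_norm, ← map_sub]
  calc ‖S g (hu.toLp u - ξ)‖ ≤ C * ‖hu.toLp u - ξ‖ :=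
        (S g).le_of_opNorm_le (norm_translation_le hS hc (h g hg)) _
    _ ≤ (C + 1) * ‖hu.toLp u - ξ‖ := by gcongr; linarith
    _ < (C + 1) * (ε / (C + 1)) := by gcongr
    _ = ε := by field_simp

end Translation

theorem exists_isRightTranslationRep_walkWeight {G : Type*} [Group G] [TopologicalSpace G]
    [IsTopologicalGroup G] [T2Space G] [LocallyCompactSpace G] [SecondCountableTopology G]
    [MeasurableSpace G] [BorelSpace G] (K : ℕ → Subgroup G) [∀ n, CompactSpace (K n)]
    (hK_open : ∀ n, IsOpen (K n : Set G)) (hK_mono : Monotone K)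
    (hK_union : ⋃ n, (K n : Set G) = Set.univ)
    (p : ℕ → ℝ) (hp_pos : ∀ n, 0 < p n) (hp_sum : HasSum p 1) :
    ∃ S : G →* (Lp ℝ 2 (walkWeight (haarMixture K p) p) →L[ℝ]
        Lp ℝ 2 (walkWeight (haarMixture K p) p)),
      IsRightTranslationRep (walkWeight (haarMixture K p) p) S := by
  have := isProbabilityMeasure_walkWeight K hp_pos hp_sum
  have hmem : ∀ g : G, ∃ n, g ∈ K n := fun g => by
    simpa using (hK_union ▸ Set.mem_univ g : g ∈ ⋃ n, (K n : Set G))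
  obtain ⟨S, hS⟩ := exists_translationRep (w := walkWeight (haarMixture K p) p) fun g => by
    obtain ⟨n, hn⟩ := hmem g
    obtain ⟨c, hc, h⟩ := exists_map_mul_right_walkWeight_le hK_open hK_mono hp_pos hp_sum n
    exact ⟨c, hc, h g hn⟩
  refine ⟨S, isRightTranslationRep_of_le hS fun g => ?_⟩
  obtain ⟨n, hn⟩ := hmem g
  obtain ⟨c, hc, h⟩ := exists_map_mul_right_walkWeight_le hK_open hK_mono hp_pos hp_sum n
  exact ⟨K n, (hK_open n).mem_nhds hn, c, hc, h⟩

/-! ### Orbit functions as an equivariant measurable map into `L²(G, w)`. -/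

section OrbitLp

open Measure Filter Topology

/-- A closed set is the zero set of the infimum of the distances to a countable dense subset of it.
-/
theorem measurable_of_measurable_edist {α E : Type*} [MeasurableSpace α] [PseudoEMetricSpace E]
    [SecondCountableTopology E] [MeasurableSpace E] [BorelSpace E] {f : α → E}
    (h : ∀ y, Measurable fun x => edist (f x) y) : Measurable f := by
  refine measurable_of_isClosed fun C hC => ?_
  obtain ⟨s, hsC, hs, hCs⟩ :=
    (TopologicalSpace.IsSeparable.of_separableSpace C).exists_countable_dense_subset
  have hcl : closure s = C := (hC.closure_subset_iff.2 hsC).antisymm hCs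
  have : f ⁻¹' C = {x | ⨅ y ∈ s, edist (f x) y = 0} := by
    ext x
    rw [Set.mem_preimage, ← hcl, Metric.mem_closure_iff_infEDist_zero]
    rfl
  rw [this]
  exact (Measurable.biInf s hs fun y _ => h y) (measurableSet_singleton 0)

variable {G X : Type*} [Group G] [MeasurableSpace G] [MulAction G X]

/-- The class in `L²(G, w)` of the function `g ↦ f (g • x)`, or `0` if it is not square
integrable. -/
noncomputable def orbitLp (w : Measure G) (f : X → ℝ) (x : X) : Lp ℝ 2 w :=
  open Classical in
  if h : MemLp (fun g : G => f (g • x)) 2 w then h.toLp _ else 0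

theorem coeFn_orbitLp {w : Measure G} {f : X → ℝ} {x : X}
    (h : MemLp (fun g : G => f (g • x)) 2 w) : orbitLp w f x =ᵐ[w] fun g => f (g • x) := by
  rw [orbitLp, dif_pos h]
  exact h.coeFn_toLp

theorem orbitLp_of_not_memLp {w : Measure G} {f : X → ℝ} {x : X}
    (h : ¬ MemLp (fun g : G => f (g • x)) 2 w) : orbitLp w f x = 0 := dif_neg h

theorem edist_orbitLp {w : Measure G} {f : X → ℝ} {x : X}
    (h : MemLp (fun g : G => f (g • x)) 2 w) (ξ : Lp ℝ 2 w) :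
    edist (orbitLp w f x) ξ = eLpNorm (fun g => f (g • x) - ξ g) 2 w := by
  rw [Lp.edist_def]
  exact eLpNorm_congr_ae ((coeFn_orbitLp h).sub .rfl)

theorem memLp_orbit_smul [TopologicalSpace G] {w : Measure G}
    {S : G →* (Lp ℝ 2 w →L[ℝ] Lp ℝ 2 w)} (hS : IsRightTranslationRep w S) {f : X → ℝ} {x : X}
    (h : MemLp (fun g : G => f (g • x)) 2 w) (a : G) :
    MemLp (fun g : G => f (g • a • x)) 2 w := by
  refine (memLp_congr_ae ?_).1 (Lp.memLp (S a (orbitLp w f x)))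
  filter_upwards [hS.apply_ae a (orbitLp w f x), (hS.quasi a).ae (coeFn_orbitLp h)] with g h1 h2
  rw [h1, h2, mul_smul]

theorem memLp_orbit_smul_iff [TopologicalSpace G] {w : Measure G}
    {S : G →* (Lp ℝ 2 w →L[ℝ] Lp ℝ 2 w)} (hS : IsRightTranslationRep w S) {f : X → ℝ} {x : X}
    (a : G) :
    MemLp (fun g : G => f (g • a • x)) 2 w ↔ MemLp (fun g : G => f (g • x)) 2 w :=
  ⟨fun h => by simpa using memLp_orbit_smul hS h a⁻¹, fun h => memLp_orbit_smul hS h a⟩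

/-- This holds at every point: square integrability is constant along orbits, and the default value
`0` is fixed by `S a`. -/
theorem orbitLp_smul [TopologicalSpace G] {w : Measure G}
    {S : G →* (Lp ℝ 2 w →L[ℝ] Lp ℝ 2 w)} (hS : IsRightTranslationRep w S) (f : X → ℝ) (x : X)
    (a : G) : orbitLp w f (a • x) = S a (orbitLp w f x) := by
  by_cases h : MemLp (fun g : G => f (g • x)) 2 w
  · refine Lp.ext ?_
    filter_upwards [coeFn_orbitLp (memLp_orbit_smul hS h a), hS.apply_ae a (orbitLp w f x),
      (hS.quasi a).ae (coeFn_orbitLp h)] with g h1 h2 h3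
    rw [h1, h2, h3, mul_smul]
  · rw [orbitLp_of_not_memLp h, orbitLp_of_not_memLp (mt (memLp_orbit_smul_iff hS a).1 h), map_zero]

variable [MeasurableSpace X]

theorem memLp_orbit_of_bounded [MeasurableSMul₂ G X] {w : Measure G} [IsFiniteMeasure w]
    {f : X → ℝ} (hf : Measurable f) {B : ℝ} (hB : ∀ x, |f x| ≤ B) (x : X) :
    MemLp (fun g : G => f (g • x)) 2 w :=
  MemLp.of_bound (hf.comp (measurable_smul_const x)).aestronglyMeasurable B
    (Eventually.of_forall fun _ => hB _)

theorem measurable_eLpNorm_orbit_sub [MeasurableSMul₂ G X] {w : Measure G} [SFinite w]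
    {f : X → ℝ} (hf : Measurable f) {v : G → ℝ} (hv : Measurable v) :
    Measurable fun x : X => eLpNorm (fun g : G => f (g • x) - v g) 2 w := by
  simp only [eLpNorm_eq_lintegral_rpow_enorm_toReal (show (2 : ℝ≥0∞) ≠ 0 by simp)
    (show (2 : ℝ≥0∞) ≠ ∞ by simp)]
  refine Measurable.pow_const (Measurable.lintegral_prod_left'
    (f := fun z : G × X => ‖f (z.1 • z.2) - v z.1‖ₑ ^ (2 : ℝ≥0∞).toReal) ?_) _
  exact ((hf.comp measurable_smul).sub (hv.comp measurable_fst)).enorm.pow_const _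

theorem measurableSet_memLp_orbit [MeasurableSMul₂ G X] {w : Measure G} [SFinite w]
    {f : X → ℝ} (hf : Measurable f) :
    MeasurableSet {x : X | MemLp (fun g : G => f (g • x)) 2 w} := by
  have h := measurable_eLpNorm_orbit_sub (w := w) hf (v := 0) measurable_zero
  simp only [Pi.zero_apply, sub_zero] at h
  convert! measurableSet_lt h (measurable_const (a := (∞ : ℝ≥0∞))) using 1
  ext x
  exact ⟨fun hx => hx.2, fun hx => ⟨(hf.comp (measurable_smul_const x)).aestronglyMeasurable, hx⟩⟩

theorem measurable_orbitLp [MeasurableSMul₂ G X] {w : Measure G} [SFinite w]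
    [SecondCountableTopology (Lp ℝ 2 w)] [MeasurableSpace (Lp ℝ 2 w)] [BorelSpace (Lp ℝ 2 w)]
    {f : X → ℝ} (hf : Measurable f) : Measurable (orbitLp w f : X → Lp ℝ 2 w) := by
  classical
  refine measurable_of_measurable_edist fun ξ => ?_
  have : (fun x : X => edist (orbitLp w f x) ξ) = fun x =>
      if x ∈ {x : X | MemLp (fun g : G => f (g • x)) 2 w} then
        eLpNorm (fun g => f (g • x) - ξ g) 2 w else edist 0 ξ := by
    ext x
    split_ifs with h
    · exact edist_orbitLp h ξ
    · rw [orbitLp_of_not_memLp h]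
  rw [this]
  exact Measurable.ite (measurableSet_memLp_orbit hf)
    (measurable_eLpNorm_orbit_sub hf (Lp.stronglyMeasurable ξ).measurable) measurable_const

/-- Tonelli and invariance of `μ`. Through this identity, `L²(μ)`-closeness of functions controls
their orbit functions in mean square. -/
theorem lintegral_eLpNorm_orbit_sq [MeasurableSMul₂ G X] {w : Measure G} [IsProbabilityMeasure w]
    {μ : Measure X} [SFinite μ] [SMulInvariantMeasure G X μ] {f : X → ℝ} (hf : Measurable f) :
    ∫⁻ x, eLpNorm (fun g : G => f (g • x)) 2 w ^ 2 ∂μ = eLpNorm f 2 μ ^ 2 := by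
  simp only [eLpNorm_two_sq]
  have hm : Measurable fun z : X × G => ‖f (z.2 • z.1)‖ₑ ^ 2 :=
    (hf.comp (measurable_smul.comp measurable_swap)).enorm.pow_const _
  rw [lintegral_lintegral_swap hm.aemeasurable]
  have : ∀ g : G, ∫⁻ x, ‖f (g • x)‖ₑ ^ 2 ∂μ = ∫⁻ x, ‖f x‖ₑ ^ 2 ∂μ := fun g =>
    (measurePreserving_smul g μ).lintegral_comp (hf.enorm.pow_const 2)
  simp [this]

theorem ae_memLp_orbit [MeasurableSMul₂ G X] {w : Measure G} [IsProbabilityMeasure w]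
    {μ : Measure X} [SFinite μ] [SMulInvariantMeasure G X μ] {f : X → ℝ} (hf : Measurable f)
    (h : MemLp f 2 μ) : ∀ᵐ x ∂μ, MemLp (fun g : G => f (g • x)) 2 w := by
  have hm := measurable_eLpNorm_orbit_sub (w := w) hf (v := 0) measurable_zero
  simp only [Pi.zero_apply, sub_zero] at hm
  have := ae_lt_top (hm.pow_const 2) (μ := μ) (by
    rw [lintegral_eLpNorm_orbit_sq hf]; exact ENNReal.pow_ne_top h.2.ne)
  filter_upwards [this] with x hx
  refine ⟨(hf.comp (measurable_smul_const x)).aestronglyMeasurable, ?_⟩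
  by_contra htop
  rw [not_lt, top_le_iff] at htop
  simp [htop] at hx

end OrbitLp

/-! ### Rewriting a function near a compact piece of an orbit. -/

section Tower

open Measure Filter Topology

theorem infinite_quotient_of_compact {G : Type*} [Group G] [TopologicalSpace G]
    [IsTopologicalGroup G] [NoncompactSpace G] (K : Subgroup G) [CompactSpace K] :
    Infinite (G ⧸ K) := by
  by_contra hfin
  rw [not_infinite_iff_finite] at hfin
  refine noncompact_univ G ?_
  have hK : IsCompact (K : Set G) := isCompact_iff_compactSpace.2 inferInstance
  have : (Set.univ : Set G) = ⋃ q : G ⧸ K, (fun k => q.out * k) '' (K : Set G) := by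
    refine Eq.symm (Set.eq_univ_of_forall fun g => ?_)
    refine Set.mem_iUnion.2 ⟨g, ?_⟩
    refine ⟨(g : G ⧸ K).out⁻¹ * g, ?_, by group⟩
    exact QuotientGroup.eq.1 (QuotientGroup.out_eq' _)
  rw [this]
  exact isCompact_iUnion fun q => hK.image (continuous_const_mul _)

open Pointwise in
/-- The orbit of a point with trivial stabilizer under a compact subgroup is a null set for every
finite invariant measure of a noncompact group. -/
theorem measure_image_smul_eq_zero {G X : Type*} [Group G] [TopologicalSpace G]
    [IsTopologicalGroup G] [NoncompactSpace G] [MeasurableSpace G] [MeasurableSpace X]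
    [MulAction G X] [MeasurableSMul G X] {μ : Measure X} [IsFiniteMeasure μ]
    [SMulInvariantMeasure G X μ] (K : Subgroup G) [CompactSpace K] {x : X}
    (hx : ∀ g : G, g • x = x → g = 1)
    (hm : MeasurableSet ((fun g : G => g • x) '' (K : Set G))) :
    μ ((fun g : G => g • x) '' (K : Set G)) = 0 := by
  have := infinite_quotient_of_compact K
  set E := (fun g : G => g • x) '' (K : Set G) with hE
  set a : ℕ → G := fun n => (Infinite.natEmbedding (G ⧸ K) n).out with ha
  -- Freeness makes the translates by representatives of distinct left cosets disjoint; infinitely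
  -- many sets of equal measure then force measure zero.
  have hdisj : Pairwise (Function.onFun Disjoint fun n => a n • E) := by
    intro i j hij
    refine Set.disjoint_left.2 ?_
    rintro _ ⟨_, ⟨k, hk, rfl⟩, rfl⟩ ⟨_, ⟨l, hl, rfl⟩, h⟩
    refine hij ((Infinite.natEmbedding (G ⧸ K)).injective ?_)
    have h1 : ((a i * k)⁻¹ * (a j * l)) • x = x := by
      simp only at h
      rw [mul_smul, mul_smul (a j), h, ← mul_smul (a i), inv_smul_smul]
    have h2 : a j * l = a i * k := (inv_mul_eq_one.1 (hx _ h1)).symm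
    rw [← QuotientGroup.out_eq' (Infinite.natEmbedding (G ⧸ K) i),
      ← QuotientGroup.out_eq' (Infinite.natEmbedding (G ⧸ K) j)]
    refine QuotientGroup.eq.2 ?_
    change (a i)⁻¹ * a j ∈ K
    have : (a i)⁻¹ * a j = k * l⁻¹ := by
      rw [eq_mul_inv_iff_mul_eq, mul_assoc, h2]; group
    rw [this]
    exact K.mul_mem hk (K.inv_mem hl)
  by_contra h0
  have hsum : μ (⋃ n, a n • E) = ∑' _ : ℕ, μ E := by
    rw [measure_iUnion hdisj fun n => hm.const_smul (a n)]
    exact tsum_congr fun n => measure_smul _ _ _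
  rw [ENNReal.tsum_const_eq_top_of_ne_zero h0] at hsum
  exact measure_ne_top μ _ hsum

theorem exists_rational_rounding {η : ℝ} (hη : 0 < η) :
    ∃ ρ : ℝ → ℝ, Measurable ρ ∧ (∀ t, ρ t ∈ Set.range ((↑) : ℚ → ℝ)) ∧ ∀ t, |ρ t - t| ≤ η := by
  obtain ⟨N, hN⟩ := exists_nat_gt (1 / η)
  have hN0 : (0 : ℝ) < N := lt_trans (by positivity) hN
  refine ⟨fun t => ⌊t * N⌋ / N, ?_, fun t => ⟨⌊t * N⌋ / N, by push_cast; rfl⟩, fun t => ?_⟩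
  · exact ((measurable_from_top (f := fun z : ℤ => (z : ℝ))).comp
      (Int.measurable_floor.comp (measurable_id.mul_const _))).div_const _
  · have h1 := Int.floor_le (t * N)
    have h2 := Int.lt_floor_add_one (t * N)
    have h3 : (⌊t * N⌋ : ℝ) / N - t = (⌊t * N⌋ - t * N) / N := by field_simp
    rw [h3, abs_div, abs_of_pos hN0, div_le_iff₀ hN0, abs_le]
    have : 1 < η * N := by rwa [div_lt_iff₀' hη] at hN
    constructor <;> linarith

/-- On compact `K` the uniform boundedness principle gives one Lipschitz constant for all `S k`,
which upgrades separate to joint continuity. -/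
theorem continuous_rep_uncurry {G E : Type*} [Group G] [TopologicalSpace G]
    [NormedAddCommGroup E] [NormedSpace ℝ E] [CompleteSpace E] {S : G →* (E →L[ℝ] E)}
    (hS : ∀ ξ, Continuous fun g => S g ξ) (K : Subgroup G) [CompactSpace K] :
    Continuous fun z : E × K => S z.2 z.1 := by
  obtain ⟨C, hC⟩ := banach_steinhaus (g := fun k : K => S k) fun ξ => by
    obtain ⟨C, hC⟩ := (isCompact_range ((hS ξ).comp continuous_subtype_val :
      Continuous fun k : K => S k ξ)).isBounded.exists_norm_le
    exact ⟨C, fun k => hC _ ⟨k, rfl⟩⟩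
  have hC0 : 0 ≤ C := (norm_nonneg _).trans (hC 1)
  refine continuous_prod_of_continuous_lipschitzWith _ C.toNNReal
    (fun ξ => (hS ξ).comp continuous_subtype_val) fun k => ?_
  refine LipschitzWith.of_dist_le_mul fun ξ ζ => ?_
  rw [dist_eq_norm, dist_eq_norm, ← map_sub, Real.coe_toNNReal C hC0]
  exact (S k).le_of_opNorm_le (hC k) _

theorem exists_measure_compl_lt {G : Type*} [Group G] [MeasurableSpace G] (w : Measure G)
    [IsFiniteMeasure w] {K : ℕ → Subgroup G} (hm : ∀ n, MeasurableSet (K n : Set G))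
    (hK_mono : Monotone K) (hK_union : ⋃ n, (K n : Set G) = Set.univ) {δ : ℝ≥0∞} (hδ : 0 < δ) :
    ∃ n, w (K n : Set G)ᶜ < δ := by
  have h := tendsto_measure_iInter_atTop (μ := w) (s := fun n => (K n : Set G)ᶜ)
    (fun n => (hm n).compl.nullMeasurableSet)
    (fun i j hij => Set.compl_subset_compl.2 (hK_mono hij)) ⟨0, measure_ne_top _ _⟩
  rw [← Set.compl_iUnion, hK_union, Set.compl_univ, measure_empty] at h
  exact (h.eventually (gt_mem_nhds hδ)).exists

/-- A bounded function `f` can be changed on a set of small measure, taking rational values there,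
so that on a set of points `x` of positive measure the function `g ↦ f (g • x)` is close to `u` on
the compact subgroup `K`. -/
theorem exists_modification_on_tower {G X E : Type*} [Group G] [TopologicalSpace G]
    [IsTopologicalGroup G] [NoncompactSpace G] [MeasurableSpace G] [BorelSpace G]
    [MeasurableSpace X] [MulAction G X] [MeasurableSMul G X]
    [NormedAddCommGroup E] [NormedSpace ℝ E] [CompleteSpace E] [SecondCountableTopology E]
    [MeasurableSpace E] [BorelSpace E]
    {S : G →* (E →L[ℝ] E)} (hS : ∀ ξ, Continuous fun g => S g ξ)
    {μ : Measure X} [IsProbabilityMeasure μ] [SMulInvariantMeasure G X μ]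
    (hfree : ∀ᵐ x ∂μ, ∀ g : G, g • x = x → g = 1)
    {ψ : X → E} (hψ : Measurable ψ) (hψi : Function.Injective ψ)
    (hψe : ∀ (g : G) (x : X), ψ (g • x) = S g (ψ x))
    (K : Subgroup G) [CompactSpace K] (u : BoundedContinuousFunction G ℝ)
    {f : X → ℝ} (hf : Measurable f) {B : ℝ} (hB : ∀ x, |f x| ≤ B) {η : ℝ} (hη : 0 < η)
    (hη1 : η ≤ 1) {δ : ℝ≥0∞} (hδ : 0 < δ) :
    ∃ f' : X → ℝ, Measurable f' ∧ (∀ x, f' x = f x ∨ f' x ∈ Set.range ((↑) : ℚ → ℝ)) ∧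
      (∀ x, |f' x| ≤ max B (‖u‖ + 1)) ∧ μ {x | f' x ≠ f x} < δ ∧
      ∃ V : Set X, 0 < μ V ∧ ∀ x ∈ V, ∀ k ∈ K, |f' (k • x) - u k| ≤ 2 * η := by
  classical
  have : IsProbabilityMeasure (μ.map ψ) := isProbabilityMeasure_map hψ.aemeasurable
  -- Through `ψ` the topology of `E` becomes available: every neighbourhood of `ψ x₀` has positive
  -- measure.
  obtain ⟨x₀, hx₀, hsupp⟩ : ∃ x₀, (∀ g : G, g • x₀ = x₀ → g = 1) ∧ ψ x₀ ∈ (μ.map ψ).support :=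
    (hfree.and (ae_of_ae_map hψ.aemeasurable (support_mem_ae (μ := μ.map ψ)))).exists
  have hjoint := continuous_rep_uncurry hS K
  set e : K → E := fun k => S k (ψ x₀) with he
  have hec : Continuous e := (hS _).comp continuous_subtype_val
  have hee : ∀ k : K, e k = ψ ((k : G) • x₀) := fun k => (hψe _ _).symm
  have hei : Function.Injective e := by
    intro k l hkl
    rw [hee, hee] at hkl
    have h1 : ((k : G)⁻¹ * l) • x₀ = x₀ := by rw [mul_smul, ← hψi hkl, inv_smul_smul]
    exact Subtype.ext (inv_mul_eq_one.1 (hx₀ _ h1))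
  have hecl : IsClosedEmbedding e := hec.isClosedEmbedding hei
  -- Tietze: `u`, transported to the compact `K`-orbit of `ψ x₀`, extends to `E` with the same norm.
  obtain ⟨F, hFn, hF⟩ := (u.compContinuous ⟨((↑) : K → G), continuous_subtype_val⟩)
    |>.exists_extension_norm_eq_of_isClosedEmbedding hecl
  have hFu : ‖F‖ ≤ ‖u‖ := hFn.trans_le (BoundedContinuousFunction.norm_compContinuous_le _ _)
  have hFe : ∀ k : K, F (S k (ψ x₀)) = u k := fun k => congrFun hF k
  have hnull : μ.map ψ (Set.range e) = 0 := by
    rw [map_apply hψ hecl.isClosed_range.measurableSet]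
    have hpre : ψ ⁻¹' Set.range e = (fun g : G => g • x₀) '' (K : Set G) := by
      ext x
      constructor
      · rintro ⟨k, hk⟩
        rw [hee] at hk
        exact ⟨k, k.2, hψi hk⟩
      · rintro ⟨k, hk, rfl⟩
        exact ⟨⟨k, hk⟩, hee _⟩
    have hme := hψ hecl.isClosed_range.measurableSet
    rw [hpre] at hme ⊢
    exact measure_image_smul_eq_zero K hx₀ hme
  obtain ⟨W, hWe, hWo, hWδ⟩ := (Set.range e).exists_isOpen_lt_of_lt δ (hnull.trans_lt hδ)
  -- Tube lemma: for `y` near `ψ x₀`, `F` follows `u` along the whole `K`-orbit of `y`, which stays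
  -- in the small set `W`.
  have hev : ∀ᶠ y in 𝓝 (ψ x₀), ∀ k : K, k ∈ (Set.univ : Set K) →
      (|F (S k y) - u k| < η ∧ S k y ∈ W) := by
    refine isCompact_univ.eventually_forall_of_forall_eventually fun k _ => ?_
    refine Filter.Eventually.and ?_ ?_
    · have hc : Continuous fun z : E × K => |F (S z.2 z.1) - u z.2| :=
        ((F.continuous.comp hjoint).sub (u.continuous.comp
          (continuous_subtype_val.comp continuous_snd))).abs
      refine hc.continuousAt.eventually (gt_mem_nhds ?_)
      simpa [hFe] using hη
    · exact hjoint.continuousAt.eventually (hWo.mem_nhds (hWe ⟨k, rfl⟩))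
  obtain ⟨N, hN, hNo, hxN⟩ := mem_nhds_iff.1 hev
  obtain ⟨ρ, hρm, hρq, hρ⟩ := exists_rational_rounding hη
  -- `O` is the union of the sets `S k '' N`; the new function is the rounded `F ∘ ψ` over it.
  set O : Set E := ⋃ k : K, S (k : G)⁻¹ ⁻¹' N with hO
  have hOo : IsOpen O := isOpen_iUnion fun k => hNo.preimage (S _).continuous
  have hSS : ∀ (g : G) (y : E), S g (S g⁻¹ y) = y := fun g y => by
    rw [← mul_apply_eq_comp, ← map_mul, mul_inv_cancel, map_one]; rfl
  have hOW : O ⊆ W := by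
    intro y hy
    obtain ⟨k, hk⟩ := Set.mem_iUnion.1 hy
    have := (hN hk k (Set.mem_univ _)).2
    rwa [hSS] at this
  refine ⟨fun x => if x ∈ ψ ⁻¹' O then ρ (F (ψ x)) else f x,
    Measurable.ite (hψ hOo.measurableSet) (hρm.comp (F.continuous.measurable.comp hψ)) hf,
    fun x => ?_, fun x => ?_, ?_, ψ ⁻¹' N, ?_, fun x hx k hk => ?_⟩
  · dsimp only
    split_ifs
    · exact Or.inr (hρq _)
    · exact Or.inl rfl
  · dsimp only
    split_ifs
    · refine le_max_of_le_right ?_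
      have h1 := hρ (F (ψ x))
      have h2 : |F (ψ x)| ≤ ‖F‖ := F.norm_coe_le_norm _
      have h3 := abs_sub_abs_le_abs_sub (ρ (F (ψ x))) (F (ψ x))
      linarith
    · exact le_max_of_le_left (hB x)
  · refine (measure_mono fun x hx => ?_).trans_lt
      ((map_apply hψ hWo.measurableSet).symm.trans_lt hWδ)
    by_contra hxW
    exact hx (if_neg fun hxO => hxW (hOW hxO))
  · rw [← map_apply hψ hNo.measurableSet]
    exact (mem_support_iff_forall _).1 hsupp N (hNo.mem_nhds hxN)
  · have hkO : k • x ∈ ψ ⁻¹' O := by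
      refine Set.mem_iUnion.2 ⟨⟨k, hk⟩, ?_⟩
      simp only [Set.mem_preimage]
      rw [← hψe, inv_smul_smul]
      exact hx
    simp only [if_pos hkO]
    have h1 := (hN hx ⟨k, hk⟩ (Set.mem_univ _)).1
    have h2 := hρ (F (ψ (k • x)))
    rw [hψe] at h2 ⊢
    have h3 := abs_sub_le (ρ (F (S k (ψ x)))) (F (S k (ψ x))) (u k)
    simp only at h1
    linarith

end Tower

/-! ### Hitting one ball of `L²(G, w)` in a way stable under perturbation. -/

section Stage

open Measure Filter Topology

theorem eLpNorm_two_sq_le_of_abs_le {α : Type*} [MeasurableSpace α] {w : Measure α} {A : Set α}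
    (hA : MeasurableSet A) {v : α → ℝ} {η D : ℝ} (hη : ∀ x ∈ A, |v x| ≤ η) (hD : ∀ x, |v x| ≤ D) :
    eLpNorm v 2 w ^ 2 ≤ ENNReal.ofReal η ^ 2 * w A + ENNReal.ofReal D ^ 2 * w Aᶜ := by
  rw [eLpNorm_two_sq, ← lintegral_add_compl _ hA, ← setLIntegral_const, ← setLIntegral_const]
  gcongr ?_ + ?_
  · refine setLIntegral_mono' hA fun x hx => ?_
    rw [← ofReal_norm]
    gcongr
    exact hη x hx
  · refine setLIntegral_mono' hA.compl fun x _ => ?_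
    rw [← ofReal_norm]
    gcongr
    exact hD x

theorem ENNReal.mul_div_add_one_le (c a : ℝ≥0∞) : c * (a / (c + 1)) ≤ a :=
  (mul_le_mul_left le_self_add _).trans ENNReal.mul_div_le

/-- Every bounded function can be changed a little, taking rational values where it changes, so
that for it and for all functions near it the orbit functions hit a given ball of `L²(G, w)` with
positive probability. -/
theorem exists_stable_modification {G X E : Type*} [Group G] [TopologicalSpace G]
    [IsTopologicalGroup G] [NoncompactSpace G] [T2Space G] [LocallyCompactSpace G]
    [SecondCountableTopology G] [MeasurableSpace G] [BorelSpace G]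
    [MeasurableSpace X] [MulAction G X] [MeasurableSMul₂ G X]
    [NormedAddCommGroup E] [NormedSpace ℝ E] [CompleteSpace E] [SecondCountableTopology E]
    [MeasurableSpace E] [BorelSpace E]
    {S : G →* (E →L[ℝ] E)} (hS : ∀ ξ, Continuous fun g => S g ξ)
    {μ : Measure X} [IsProbabilityMeasure μ] [SMulInvariantMeasure G X μ]
    (hfree : ∀ᵐ x ∂μ, ∀ g : G, g • x = x → g = 1)
    {ψ : X → E} (hψ : Measurable ψ) (hψi : Function.Injective ψ)
    (hψe : ∀ (g : G) (x : X), ψ (g • x) = S g (ψ x))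
    {K : ℕ → Subgroup G} [∀ n, CompactSpace (K n)] (hK_open : ∀ n, IsOpen (K n : Set G))
    (hK_mono : Monotone K) (hK_union : ⋃ n, (K n : Set G) = Set.univ)
    {w : Measure G} [IsProbabilityMeasure w] (ξ : Lp ℝ 2 w) {ε : ℝ} (hε : 0 < ε)
    {f : X → ℝ} (hf : Measurable f) (hB : ∃ B, ∀ x, |f x| ≤ B) {r : ℝ≥0∞} (hr : 0 < r) :
    ∃ (f' : X → ℝ) (r' : ℝ≥0∞), Measurable f' ∧ (∃ B, ∀ x, |f' x| ≤ B) ∧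
      (∀ x, f' x = f x ∨ f' x ∈ Set.range ((↑) : ℚ → ℝ)) ∧ μ {x | f' x ≠ f x} ≤ r / 2 ∧
      eLpNorm (f' - f) 2 μ ≤ r / 2 ∧ 0 < r' ∧ r' ≤ r / 2 ∧
      ∀ g : X → ℝ, Measurable g → eLpNorm (g - f') 2 μ ≤ r' →
        0 < μ {x | eLpNorm (fun h : G => g (h • x) - ξ h) 2 w < ENNReal.ofReal ε} := by
  obtain ⟨B, hB⟩ := hB
  obtain ⟨u, hu, huξ⟩ := exists_boundedContinuous_norm_toLp_sub_lt ξ (show 0 < ε / 4 by positivity)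
  -- `D` will bound `|f' - u|` and `D'` will bound `|f' - f|`.
  set D := max B (‖u‖ + 1) + ‖u‖ with hD
  set D' := max B (‖u‖ + 1) + B with hD'
  have he : 0 < ENNReal.ofReal (ε / 8) := by simpa using hε
  have hr2 : 0 < r / 2 := ENNReal.half_pos hr.ne'
  -- The complement of `K n` contributes at most `(ε / 8) ^ 2` to the squared distance; the `+ 1`
  -- keeps the denominator nonzero.
  obtain ⟨n, hn⟩ := exists_measure_compl_lt w (fun n => (hK_open n).measurableSet) hK_mono hK_union
    (δ := ENNReal.ofReal (ε / 8) ^ 2 / (ENNReal.ofReal D ^ 2 + 1))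
    (ENNReal.div_pos (ENNReal.pow_pos he 2).ne' (by finiteness))
  obtain ⟨f', hf', hq, hbd, hμ, V, hV, hVu⟩ := exists_modification_on_tower hS hfree hψ hψi hψe
    (K n) u hf hB (η := min 1 (ε / 16)) (by positivity) (min_le_left _ _)
    (δ := min (r / 2) ((r / 2) ^ 2 / (ENNReal.ofReal D' ^ 2 + 1)))
    (lt_min hr2 (ENNReal.div_pos (ENNReal.pow_pos hr2 2).ne' (by finiteness)))
  have ha : 0 < ENNReal.ofReal (ε / 4) := by simpa using hε
  set a := ENNReal.ofReal (ε / 4) ^ 2 * μ V with ha_def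
  have ha0 : a ≠ 0 := (ENNReal.mul_pos (ENNReal.pow_pos ha 2).ne' hV.ne').ne'
  have hat : a ≠ ∞ := by finiteness
  -- The bounds `1` and `a / 2` give `r' ^ 2 ≤ a / 2`, so by Markov the exceptional set below has at
  -- most half the measure of `V`.
  refine ⟨f', min (r / 2) (min 1 (a / 2)), hf', ⟨_, hbd⟩, hq, hμ.le.trans (min_le_left _ _), ?_,
    lt_min hr2 (lt_min one_pos (ENNReal.half_pos ha0)), min_le_left _ _, fun g hg hgr => ?_⟩
  · have h := eLpNorm_two_sq_le_of_abs_le (w := μ) (A := {x | f' x = f x}) (v := f' - f)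
      (η := 0) (D := D') (measurableSet_eq_fun hf' hf)
      (fun x hx => by simp [show f' x = f x from hx]) (fun x => by
        have := abs_sub (f' x) (f x)
        simp only [Pi.sub_apply]
        linarith [hbd x, hB x])
    rw [← ENNReal.pow_le_pow_left_iff two_ne_zero]
    refine h.trans ?_
    rw [ENNReal.ofReal_zero, zero_pow two_ne_zero, zero_mul, zero_add]
    refine le_trans ?_ (ENNReal.mul_div_add_one_le (ENNReal.ofReal D' ^ 2) _)
    gcongr
    exact hμ.le.trans (min_le_right _ _)
  · have hclose : ∀ x ∈ V, eLpNorm (fun h : G => f' (h • x) - u h) 2 w ≤ ENNReal.ofReal (ε / 4) := by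
      intro x hx
      have h := eLpNorm_two_sq_le_of_abs_le (w := w) (A := (K n : Set G))
        (v := fun h : G => f' (h • x) - u h) (η := ε / 8) (D := D) (hK_open n).measurableSet
        (fun k hk => (hVu x hx k hk).trans (by linarith [min_le_right 1 (ε / 16)]))
        (fun k => by
          have h1 := abs_sub (f' (k • x)) (u k)
          have h2 : |u k| ≤ ‖u‖ := u.norm_coe_le_norm k
          linarith [hbd (k • x)])
      rw [← ENNReal.pow_le_pow_left_iff two_ne_zero]
      calc _ ≤ _ := h
        _ ≤ ENNReal.ofReal (ε / 8) ^ 2 * 1 + ENNReal.ofReal D ^ 2 *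
            (ENNReal.ofReal (ε / 8) ^ 2 / (ENNReal.ofReal D ^ 2 + 1)) := by
          gcongr
          exact prob_le_one
        _ ≤ ENNReal.ofReal (ε / 8) ^ 2 * 1 + ENNReal.ofReal (ε / 8) ^ 2 := by
          gcongr
          exact ENNReal.mul_div_add_one_le _ _
        _ ≤ ENNReal.ofReal (ε / 4) ^ 2 := by
          rw [mul_one, ← ENNReal.ofReal_pow (by positivity), ← ENNReal.ofReal_pow (by positivity),
            ← ENNReal.ofReal_add (by positivity) (by positivity)]
          refine ENNReal.ofReal_le_ofReal ?_
          nlinarith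
    have hmeas : Measurable fun x : X => eLpNorm (fun h : G => (g - f') (h • x)) 2 w := by
      simpa using measurable_eLpNorm_orbit_sub (w := w) (hg.sub hf') (v := 0) measurable_zero
    set bad := {x : X | ENNReal.ofReal (ε / 4) ^ 2 ≤
      eLpNorm (fun h : G => (g - f') (h • x)) 2 w ^ 2} with hbad
    have hmarkov : ENNReal.ofReal (ε / 4) ^ 2 * μ bad ≤ a / 2 := by
      refine (mul_meas_ge_le_lintegral (hmeas.pow_const 2) _).trans ?_
      rw [lintegral_eLpNorm_orbit_sq (hg.sub hf')]
      have h1 := hgr.trans (min_le_right _ _)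
      calc eLpNorm (g - f') 2 μ ^ 2 = eLpNorm (g - f') 2 μ * eLpNorm (g - f') 2 μ := sq _
        _ ≤ 1 * (a / 2) := by
          gcongr
          · exact h1.trans (min_le_left _ _)
          · exact h1.trans (min_le_right _ _)
        _ = a / 2 := one_mul _
    have hlt : μ bad < μ V := by
      refine lt_of_mul_lt_mul_left' (a := ENNReal.ofReal (ε / 4) ^ 2) ?_
      exact hmarkov.trans_lt (ENNReal.half_lt_self ha0 hat)
    -- On `V \ bad` three errors add up, from `g` to `f'`, from `f'` to `u` and from `u` to `ξ`,
    -- each at most `ε / 4`.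
    refine ((tsub_pos_of_lt hlt).trans_le le_measure_sdiff).trans_le (measure_mono fun x hx => ?_)
    have hxb : eLpNorm (fun h : G => (g - f') (h • x)) 2 w < ENNReal.ofReal (ε / 4) := by
      refine not_le.1 fun hle => hx.2 ?_
      change ENNReal.ofReal (ε / 4) ^ 2 ≤ _
      gcongr
    have huξ' : eLpNorm (fun h : G => u h - ξ h) 2 w < ENNReal.ofReal (ε / 4) := by
      have h1 : ‖hu.toLp u - ξ‖ₑ < ENNReal.ofReal (ε / 4) := by
        rw [← ofReal_norm]
        exact (ENNReal.ofReal_lt_ofReal_iff (by positivity)).2 huξ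
      rw [Lp.enorm_def] at h1
      refine lt_of_eq_of_lt (eLpNorm_congr_ae ?_) h1
      filter_upwards [Lp.coeFn_sub (hu.toLp u) ξ, hu.coeFn_toLp] with h h1 h2
      rw [h1, Pi.sub_apply, h2]
    have hm1 : AEStronglyMeasurable (fun h : G => (g - f') (h • x)) w :=
      ((hg.sub hf').comp (measurable_smul_const x)).aestronglyMeasurable
    have hm2 : AEStronglyMeasurable (fun h : G => f' (h • x) - u h) w :=
      ((hf'.comp (measurable_smul_const x)).sub u.continuous.measurable).aestronglyMeasurable
    have hm3 : AEStronglyMeasurable (fun h : G => u h - ξ h) w :=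
      u.continuous.measurable.aestronglyMeasurable.sub (Lp.aestronglyMeasurable ξ)
    have hsum : (fun h : G => g (h • x) - ξ h) = (fun h : G => (g - f') (h • x)) +
        ((fun h : G => f' (h • x) - u h) + fun h : G => u h - ξ h) := by
      ext h; simp
    calc eLpNorm (fun h : G => g (h • x) - ξ h) 2 w
        ≤ eLpNorm (fun h : G => (g - f') (h • x)) 2 w +
          (eLpNorm (fun h : G => f' (h • x) - u h) 2 w + eLpNorm (fun h : G => u h - ξ h) 2 w) := by
          rw [hsum]
          refine (eLpNorm_add_le hm1 (hm2.add hm3) (by norm_num)).trans ?_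
          gcongr
          exact eLpNorm_add_le hm2 hm3 (by norm_num)
      _ < ENNReal.ofReal (ε / 4) + (ENNReal.ofReal (ε / 4) + ENNReal.ofReal (ε / 4)) := by
          refine ENNReal.add_lt_add hxb ?_
          exact ENNReal.add_lt_add_of_le_of_lt (ne_top_of_le_ne_top (by simp) (hclose x hx.1))
            (hclose x hx.1) huξ'
      _ ≤ ENNReal.ofReal ε := by
          rw [← ENNReal.ofReal_add (by positivity) (by positivity),
            ← ENNReal.ofReal_add (by positivity) (by positivity)]
          exact ENNReal.ofReal_le_ofReal (by linarith)

end Stage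

/-! ### Passage to the limit over countably many modifications. -/

section Limit

open Measure Filter Topology

/-- Iterating small modifications, each of which secures one of countably many stable properties,
one finds in the limit a square integrable function with all these properties. -/
theorem exists_limit_of_stable_modifications {X : Type*} [MeasurableSpace X] {μ : Measure X}
    [IsProbabilityMeasure μ] {P : ℕ → (X → ℝ) → Prop} {Q : Set ℝ} (hQ : 0 ∈ Q)
    (step : ∀ (j : ℕ) (f : X → ℝ) (r : ℝ≥0∞), Measurable f → (∃ B, ∀ x, |f x| ≤ B) → 0 < r →
      ∃ (f' : X → ℝ) (r' : ℝ≥0∞), Measurable f' ∧ (∃ B, ∀ x, |f' x| ≤ B) ∧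
        (∀ x, f' x = f x ∨ f' x ∈ Q) ∧ μ {x | f' x ≠ f x} ≤ r / 2 ∧
        eLpNorm (f' - f) 2 μ ≤ r / 2 ∧ 0 < r' ∧ r' ≤ r / 2 ∧
        ∀ g : X → ℝ, Measurable g → eLpNorm (g - f') 2 μ ≤ r' → P j g)
    {f₀ : X → ℝ} (hf₀ : Measurable f₀) (hB₀ : ∃ B, ∀ x, |f₀ x| ≤ B) :
    ∃ g : X → ℝ, Measurable g ∧ MemLp g 2 μ ∧ (∀ x, g x = f₀ x ∨ g x ∈ Q) ∧
      0 < μ {x | g x = f₀ x} ∧ ∀ j, P j g := by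
  classical
  let State := {s : (X → ℝ) × ℝ≥0∞ // Measurable s.1 ∧ (∃ B, ∀ x, |s.1 x| ≤ B) ∧ 0 < s.2}
  have step' : ∀ (j : ℕ) (s : State), ∃ t : State,
      (∀ x, t.1.1 x = s.1.1 x ∨ t.1.1 x ∈ Q) ∧ μ {x | t.1.1 x ≠ s.1.1 x} ≤ s.1.2 / 2 ∧
      eLpNorm (t.1.1 - s.1.1) 2 μ ≤ s.1.2 / 2 ∧ t.1.2 ≤ s.1.2 / 2 ∧
      ∀ g : X → ℝ, Measurable g → eLpNorm (g - t.1.1) 2 μ ≤ t.1.2 → P j g := by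
    rintro j ⟨⟨f, r⟩, hf, hB, hr⟩
    obtain ⟨f', r', h1, h2, h3, h4, h5, h6, h7, h8⟩ := step j f r hf hB hr
    exact ⟨⟨⟨f', r'⟩, h1, h2, h6⟩, h3, h4, h5, h7, h8⟩
  choose next hnext using step'
  let s : ℕ → State := fun n => Nat.rec
    ⟨⟨f₀, 2⁻¹⟩, hf₀, hB₀, ENNReal.inv_pos.2 (by simp)⟩ next n
  obtain ⟨F, r, hFz, hrz, hFm, hFQ, hFμ, hFL, hrr, hP⟩ : ∃ (F : ℕ → X → ℝ) (r : ℕ → ℝ≥0∞),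
      F 0 = f₀ ∧ r 0 = 2⁻¹ ∧ (∀ n, Measurable (F n)) ∧
      (∀ n x, F (n + 1) x = F n x ∨ F (n + 1) x ∈ Q) ∧
      (∀ n, μ {x | F (n + 1) x ≠ F n x} ≤ r n / 2) ∧
      (∀ n, eLpNorm (F (n + 1) - F n) 2 μ ≤ r n / 2) ∧ (∀ n, r (n + 1) ≤ r n / 2) ∧
      ∀ n g, Measurable g → eLpNorm (g - F (n + 1)) 2 μ ≤ r (n + 1) → P n g :=
    ⟨fun n => (s n).1.1, fun n => (s n).1.2, rfl, rfl, fun n => (s n).2.1,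
      fun n => (hnext n (s n)).1, fun n => (hnext n (s n)).2.1, fun n => (hnext n (s n)).2.2.1,
      fun n => (hnext n (s n)).2.2.2.1, fun n => (hnext n (s n)).2.2.2.2⟩
  clear_value s
  have hrg : ∀ n, r n ≤ 2⁻¹ ^ (n + 1) := by
    intro n
    induction n with
    | zero => simp [hrz]
    | succ n ih =>
      refine (hrr n).trans ?_
      rw [pow_succ, ← div_eq_mul_inv]
      gcongr
  -- Total change at most `1 / 2`: by Borel–Cantelli almost every point changes finitely often, and
  -- with positive probability it never does.
  have hsum : ∑' n, μ {x | F (n + 1) x ≠ F n x} ≤ 2⁻¹ := by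
    calc ∑' n, μ {x | F (n + 1) x ≠ F n x} ≤ ∑' n : ℕ, 2⁻¹ ^ n * 2⁻¹ ^ 2 := by
          refine ENNReal.tsum_le_tsum fun n => (hFμ n).trans ?_
          rw [div_eq_mul_inv, ← pow_add, show n + 2 = n + 1 + 1 from rfl, pow_succ _ (n + 1)]
          gcongr
          exact hrg n
      _ = 2⁻¹ := by
          rw [ENNReal.tsum_mul_right, ENNReal.tsum_geometric_two, sq, ← mul_assoc,
            ENNReal.mul_inv_cancel (by simp) (by simp), one_mul]
  -- Keeping the remaining budget `r (i + k)` on the left lets the induction close; the limit then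
  -- stays within `r i` of `F i`.
  have hdist : ∀ i k, eLpNorm (F (i + k) - F i) 2 μ + r (i + k) ≤ r i := by
    intro i k
    induction k with
    | zero => simp
    | succ k ih =>
      have hadd : F (i + (k + 1)) - F i = (F (i + k + 1) - F (i + k)) + (F (i + k) - F i) := by
        rw [← add_assoc]; abel
      calc eLpNorm (F (i + (k + 1)) - F i) 2 μ + r (i + (k + 1))
          ≤ (r (i + k) / 2 + eLpNorm (F (i + k) - F i) 2 μ) + r (i + k) / 2 := by
            gcongr
            · rw [hadd]
              refine (eLpNorm_add_le ((hFm _).sub (hFm _)).aestronglyMeasurable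
                ((hFm _).sub (hFm _)).aestronglyMeasurable (by norm_num)).trans ?_
              gcongr
              exact hFL _
            · exact hrr _
        _ = eLpNorm (F (i + k) - F i) 2 μ + r (i + k) := by
            rw [add_comm (r (i + k) / 2), add_assoc, ENNReal.add_halves]
        _ ≤ r i := ih
  set A : Set X := {x | ∃ N, ∀ i, N ≤ i → F (i + 1) x = F i x} with hA
  have hAm : MeasurableSet A := by
    have : A = ⋃ N, ⋂ i, ⋂ _ : N ≤ i, {x | F (i + 1) x = F i x} := by
      ext x; simp [hA]
    rw [this]
    exact MeasurableSet.iUnion fun N => MeasurableSet.iInter fun i => MeasurableSet.iInter fun _ =>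
      measurableSet_eq_fun (hFm _) (hFm _)
  have hAae : ∀ᵐ x ∂μ, x ∈ A := by
    filter_upwards [ae_eventually_notMem (ne_top_of_le_ne_top (by simp) hsum)] with x hx
    obtain ⟨N, hN⟩ := eventually_atTop.1 hx
    exact ⟨N, fun i hi => by simpa using hN i hi⟩
  have hF0 : ∀ n x, F n x = f₀ x ∨ F n x ∈ Q := by
    intro n x
    induction n with
    | zero => exact Or.inl (by rw [hFz])
    | succ n ih =>
      rcases hFQ n x with h | h
      · rwa [h]
      · exact Or.inr h
  -- Where the sequence never stabilizes the limit is set to `0`, whence the requirement `0 ∈ Q`.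
  have hlim : ∀ x, ∃ y, (y = f₀ x ∨ y ∈ Q) ∧ (x ∉ A → y = 0) ∧
      (x ∈ A → ∀ᶠ i in atTop, F i x = y) := by
    intro x
    by_cases hx : x ∈ A
    · obtain ⟨N, hN⟩ := hx
      refine ⟨F N x, hF0 N x, fun h => absurd ⟨N, hN⟩ h, fun _ => eventually_atTop.2 ⟨N, ?_⟩⟩
      intro i hi
      induction i, hi using Nat.le_induction with
      | base => rfl
      | succ i hi ih => rw [hN i hi, ih]
    · exact ⟨0, Or.inr hQ, fun _ => rfl, fun h => absurd h hx⟩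
  choose g hgQ hg0 hgA using hlim
  have hgm : Measurable g := by
    refine measurable_of_tendsto_metrizable (f := fun n => A.indicator (F n))
      (fun n => (hFm n).indicator hAm) (tendsto_pi_nhds.2 fun x => ?_)
    by_cases hx : x ∈ A
    · simp only [Set.indicator_of_mem hx]
      exact tendsto_const_nhds.congr' ((hgA x hx).mono fun i hi => hi.symm)
    · simp only [Set.indicator_of_notMem hx, hg0 x hx]
      exact tendsto_const_nhds
  have hgF : ∀ n, eLpNorm (g - F n) 2 μ ≤ r n := by
    intro n
    refine Lp.eLpNorm_le_of_ae_tendsto (u := atTop) (f := fun k => F (n + k) - F n)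
      (Eventually.of_forall fun k => le_self_add.trans (hdist n k))
      (fun k => ((hFm _).sub (hFm _)).aestronglyMeasurable) ?_
    filter_upwards [hAae] with x hx
    refine Tendsto.sub_const ?_ _
    refine tendsto_const_nhds.congr' ?_
    have h1 : Tendsto (fun k => n + k) atTop atTop :=
      tendsto_atTop_mono (fun k => Nat.le_add_left k n) tendsto_id
    exact (h1.eventually (hgA x hx)).mono fun i hi => hi.symm
  refine ⟨g, hgm, ?_, hgQ, ?_, fun j => hP j g hgm (hgF (j + 1))⟩
  · obtain ⟨B, hB⟩ := hB₀
    have h1 : MemLp (F 0) 2 μ := hFz ▸ MemLp.of_bound hf₀.aestronglyMeasurable B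
      (Eventually.of_forall fun x => hB x)
    have h2 : MemLp (g - F 0) 2 μ := ⟨(hgm.sub (hFm 0)).aestronglyMeasurable,
      (hgF 0).trans_lt ((hrg 0).trans_lt (by simp))⟩
    simpa using h2.add h1
  · have hU : μ (⋃ n, {x | F (n + 1) x ≠ F n x}) < μ Set.univ := by
      refine (measure_iUnion_le _).trans_lt (hsum.trans_lt ?_)
      rw [measure_univ]
      exact ENNReal.one_half_lt_one
    refine ((tsub_pos_of_lt hU).trans_le le_measure_sdiff).trans_le (measure_mono fun x hx => ?_)
    have hx' : ∀ n, F (n + 1) x = F n x := by simpa using hx.2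
    have hx0 : ∀ n, F n x = f₀ x := fun n => by
      induction n with
      | zero => rw [hFz]
      | succ n ih => rw [hx', ih]
    obtain ⟨i, hi⟩ := (hgA x ⟨0, fun i _ => hx' i⟩).exists
    exact hi.symm.trans (hx0 i)

end Limit

/-! ### Injectivity from irrational values, and universality. -/

section Universal

open Measure Filter Topology

theorem measurableSet_irrational : MeasurableSet {t : ℝ | Irrational t} :=
  (Set.countable_range ((↑) : ℚ → ℝ)).measurableSet.compl

/-- Irrational values will mark the points where rational-valued modifications have left the
function intact. -/
theorem exists_injective_irrational (X : Type*) [MeasurableSpace X] [StandardBorelSpace X] :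
    ∃ f : X → ℝ, Measurable f ∧ Function.Injective f ∧ (∀ x, Irrational (f x)) ∧
      ∀ x, |f x| ≤ 1 := by
  set I : Set ℝ := Set.Icc 0 1 ∩ {t | Irrational t} with hI
  have hIm : MeasurableSet I := measurableSet_Icc.inter measurableSet_irrational
  have := hIm.standardBorel
  have hIu : ¬ Countable I := by
    intro hc
    have h1 : (Set.Icc (0 : ℝ) 1).Countable := by
      refine ((Set.countable_coe_iff.1 hc).union (Set.countable_range ((↑) : ℚ → ℝ))).mono ?_
      intro t ht
      by_cases h : Irrational t
      · exact Or.inl ⟨ht, h⟩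
      · exact Or.inr (not_not.1 h)
    have := h1.measure_zero volume
    simp at this
  have hR : ¬ Countable ℝ := fun h => Cardinal.not_countable_real (Set.countable_univ_iff.2 h)
  let e : ℝ ≃ᵐ I := PolishSpace.measurableEquivOfNotCountable hR hIu
  refine ⟨fun x => e (embeddingReal X x), ?_, ?_, fun x => (e _).2.2, fun x => ?_⟩
  · exact measurable_subtype_coe.comp
      (e.measurable.comp (measurableEmbedding_embeddingReal X).measurable)
  · exact Subtype.val_injective.comp
      (e.injective.comp (measurableEmbedding_embeddingReal X).injective)
  · have := (e (embeddingReal X x)).2.1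
    rw [abs_of_nonneg this.1]
    exact this.2

/-- An equivariant measurable map that is injective on an invariant measurable set of full measure
is an isomorphism onto its image measure. -/
theorem isomorphicActions_map {G X Y : Type*} [MeasurableSpace X] [StandardBorelSpace X]
    [TopologicalSpace Y] [T2Space Y] [SecondCountableTopology Y] [MeasurableSpace Y] [BorelSpace Y]
    {a : G → X → X} {b : G → Y → Y} {μ : Measure X} {φ : X → Y} (hφ : Measurable φ)
    (he : ∀ g x, φ (a g x) = b g (φ x)) {X₀ : Set X} (hX₀ : MeasurableSet X₀)
    (hinv : ∀ g, ∀ x ∈ X₀, a g x ∈ X₀) (hnull : μ X₀ᶜ = 0) (hinj : Set.InjOn φ X₀) :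
    IsomorphicActions a μ b (μ.map φ) := by
  have := hX₀.standardBorel
  -- Lusin–Souslin: an injective measurable map on a standard Borel space has measurable images and
  -- inverse.
  have hemb : MeasurableEmbedding (fun x : X₀ => φ x) :=
    (hφ.comp measurable_subtype_coe).measurableEmbedding hinj.injective
  have hYm : MeasurableSet (Set.range fun x : X₀ => φ x) := hemb.measurableSet_range
  refine ⟨X₀, Set.range fun x : X₀ => φ x, hemb.equivRange, hinv, ?_, hX₀, hYm, hnull, ?_, ?_, ?_⟩
  · rintro g _ ⟨x, rfl⟩
    exact ⟨⟨a g x, hinv g x x.2⟩, he g x⟩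
  · rw [map_apply hφ hYm.compl]
    exact measure_mono_null (fun x hx (hxX : x ∈ X₀) => hx ⟨⟨x, hxX⟩, rfl⟩) hnull
  · refine ⟨hemb.equivRange.measurable, Measure.ext fun s hs => ?_⟩
    have hsY := (MeasurableEmbedding.subtype_coe hYm).measurableSet_image.2 hs
    rw [map_apply hemb.equivRange.measurable hs,
      (MeasurableEmbedding.subtype_coe hX₀).comap_apply,
      (MeasurableEmbedding.subtype_coe hYm).comap_apply, map_apply hφ hsY]
    have himg : Subtype.val '' (hemb.equivRange ⁻¹' s) = φ ⁻¹' (Subtype.val '' s) ∩ X₀ := by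
      ext x
      constructor
      · rintro ⟨y, hy, rfl⟩
        refine ⟨⟨_, hy, ?_⟩, y.2⟩
        rw [hemb.equivRange_apply]
      · rintro ⟨⟨z, hz, hzx⟩, hx⟩
        refine ⟨⟨x, hx⟩, ?_, rfl⟩
        rw [Set.mem_preimage, hemb.equivRange_apply]
        rwa [show (⟨φ x, ⟨⟨x, hx⟩, rfl⟩⟩ : Set.range fun x : X₀ => φ x) = z from
          Subtype.ext hzx.symm]
    rw [himg]
    exact measure_inter_conull hnull
  · intro g x
    rw [hemb.equivRange_apply, hemb.equivRange_apply]
    exact he g x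

variable {G X : Type*} [Group G] [MeasurableSpace G]
  [MeasurableSpace X] [MulAction G X] [MeasurableSMul₂ G X] {w : Measure G}

theorem orbitLp_injective [IsProbabilityMeasure w] {f : X → ℝ} (hf : Measurable f)
    (hfi : Function.Injective f) (hfb : ∀ x, |f x| ≤ 1) :
    Function.Injective (orbitLp w f : X → Lp ℝ 2 w) := by
  intro x y hxy
  have hx := coeFn_orbitLp (memLp_orbit_of_bounded (w := w) hf hfb x)
  have hy := coeFn_orbitLp (memLp_orbit_of_bounded (w := w) hf hfb y)
  rw [hxy] at hx
  obtain ⟨g, h1, h2⟩ := (hx.and hy).exists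
  exact MulAction.injective g (hfi (h1.symm.trans h2))

/-- Quasi-invariance of `w` makes the set exactly invariant, so ergodicity leaves only null or
conull; if it were null, Fubini and invariance of `μ` would give `μ s = 0`. -/
theorem ae_measure_orbit_mem_ne_zero [TopologicalSpace G] [IsProbabilityMeasure w]
    {S : G →* (Lp ℝ 2 w →L[ℝ] Lp ℝ 2 w)} (hS : IsRightTranslationRep w S)
    {μ : Measure X} [IsProbabilityMeasure μ] [ErgodicSMul G X μ]
    {s : Set X} (hs : MeasurableSet s) (hpos : 0 < μ s) :
    MeasurableSet {x : X | w {g : G | g • x ∈ s} ≠ 0} ∧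
      (∀ (a : G) (x : X), w {g : G | g • x ∈ s} ≠ 0 → w {g : G | g • a • x ∈ s} ≠ 0) ∧
      ∀ᵐ x ∂μ, w {g : G | g • x ∈ s} ≠ 0 := by
  have hprod : MeasurableSet {z : X × G | z.2 • z.1 ∈ s} :=
    (measurable_smul.comp measurable_swap) hs
  have hm : Measurable fun x : X => w {g : G | g • x ∈ s} := measurable_measure_prodMk_left hprod
  have hZ : MeasurableSet {x : X | w {g : G | g • x ∈ s} ≠ 0} :=
    (hm (measurableSet_singleton 0)).compl
  have hinv : ∀ (a : G) (x : X), w {g : G | g • x ∈ s} ≠ 0 → w {g : G | g • a • x ∈ s} ≠ 0 := by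
    intro a x hx h0
    refine hx ?_
    have := (hS.quasi a⁻¹).preimage_null h0
    simpa [Set.preimage, mul_smul] using this
  refine ⟨hZ, hinv, ?_⟩
  have hconst := aeconst_of_forall_preimage_smul_ae_eq (μ := μ) G hZ.nullMeasurableSet fun a => by
    refine Eq.eventuallyEq (Set.ext fun x => ⟨fun h => ?_, hinv a x⟩)
    simpa using hinv a⁻¹ (a • x) h
  rcases eventuallyConst_set.1 hconst with h | h
  · exact h
  · exfalso
    have h1 : ∀ᵐ x ∂μ, ∀ᵐ g ∂w, g • x ∉ s := by
      filter_upwards [h] with x hx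
      rw [ae_iff]
      simpa using hx
    rw [ae_ae_comm hprod.compl] at h1
    obtain ⟨g, hg⟩ := h1.exists
    have h2 : μ ((g • ·) ⁻¹' s) = 0 := measure_eq_zero_iff_ae_notMem.2 hg
    rw [(measurePreserving_smul g μ).measure_preimage hs.nullMeasurableSet] at h2
    exact hpos.ne' h2

/-- The right translation representation on `L²(G, w)` is universal, for every probability measure
`w` for which it is defined, if `G` is an increasing union of compact open subgroups. -/
theorem IsRightTranslationRep.isUniversalRep {G : Type u} [Group G] [TopologicalSpace G]
    [IsTopologicalGroup G] [T2Space G] [LocallyCompactSpace G] [SecondCountableTopology G]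
    [NoncompactSpace G] [MeasurableSpace G] [BorelSpace G]
    {K : ℕ → Subgroup G} [∀ n, CompactSpace (K n)]
    (hK_open : ∀ n, IsOpen (K n : Set G)) (hK_mono : Monotone K)
    (hK_union : ⋃ n, (K n : Set G) = Set.univ) {w : Measure G} [IsProbabilityMeasure w]
    [MeasurableSpace (Lp ℝ 2 w)] [BorelSpace (Lp ℝ 2 w)]
    {S : G →* (Lp ℝ 2 w →L[ℝ] Lp ℝ 2 w)} (hS : IsRightTranslationRep w S) :
    IsUniversalRep.{v} S := by
  intro X _ _ _ _ μ _ _ hfree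
  have : Fact ((2 : ℝ≥0∞) ≠ ∞) := ⟨by simp⟩
  have : SecondCountableTopology (Lp ℝ 2 w) := inferInstance
  obtain ⟨f₀, hf₀, hf₀i, hf₀irr, hf₀b⟩ := exists_injective_irrational X
  let d := TopologicalSpace.denseSeq (Lp ℝ 2 w)
  -- The index `j` codes a centre in a dense sequence together with a radius `1 / (m + 1)`.
  obtain ⟨f, hf, hfL, hfQ, hfpos, hfP⟩ := exists_limit_of_stable_modifications (μ := μ)
    (P := fun j g => 0 < μ {x | eLpNorm (fun h : G => g (h • x) - d j.unpair.1 h) 2 w <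
      ENNReal.ofReal (1 / (j.unpair.2 + 1))}) (Q := Set.range ((↑) : ℚ → ℝ)) ⟨0, by simp⟩
    (fun j f r hf hB hr => exists_stable_modification hS.continuous hfree
      (measurable_orbitLp (w := w) hf₀) (orbitLp_injective hf₀ hf₀i hf₀b)
      (fun g x => orbitLp_smul hS f₀ x g) hK_open hK_mono hK_union (d j.unpair.1)
      (by positivity) hf hB hr) hf₀ ⟨1, hf₀b⟩
  have hφ : Measurable (orbitLp w f : X → Lp ℝ 2 w) := measurable_orbitLp hf
  have hirr : ∀ x, Irrational (f x) → f x = f₀ x := fun x hx => (hfQ x).resolve_right hx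
  have hmem : ∀ᵐ x ∂μ, MemLp (fun g : G => f (g • x)) 2 w := ae_memLp_orbit hf hfL
  have hirrpos : 0 < μ (f ⁻¹' {t | Irrational t}) := hfpos.trans_le
    (measure_mono fun x hx => by
      change Irrational (f x)
      rw [show f x = f₀ x from hx]
      exact hf₀irr x)
  obtain ⟨hZm, hZinv, hZae⟩ := ae_measure_orbit_mem_ne_zero hS
    (hf measurableSet_irrational) hirrpos
  refine ⟨μ.map (orbitLp w f), isProbabilityMeasure_map hφ.aemeasurable, fun g => ?_,
    fun U hU hUne => ?_, isomorphicActions_map hφ (fun g x => orbitLp_smul hS f x g)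
      (X₀ := {x | MemLp (fun g : G => f (g • x)) 2 w} ∩
        {x | w {g : G | g • x ∈ f ⁻¹' {t | Irrational t}} ≠ 0})
      ((measurableSet_memLp_orbit hf).inter hZm)
      (fun g x hx => ⟨memLp_orbit_smul hS hx.1 g, hZinv g x hx.2⟩) ?_ ?_⟩
  · refine ⟨(S g).continuous.measurable, ?_⟩
    rw [map_map (S g).continuous.measurable hφ]
    have : S g ∘ orbitLp w f = orbitLp w f ∘ (g • · : X → X) :=
      funext fun x => (orbitLp_smul hS f x g).symm
    rw [this, ← map_map hφ (measurable_const_smul g), (measurePreserving_smul g μ).map_eq]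
  · rw [map_apply hφ hU.measurableSet]
    obtain ⟨ξ, hξ⟩ := hUne
    obtain ⟨ε, hε, hball⟩ := Metric.isOpen_iff.1 hU ξ hξ
    obtain ⟨m, hm⟩ := exists_nat_one_div_lt (show 0 < ε / 2 by positivity)
    obtain ⟨i, hi⟩ := (TopologicalSpace.denseRange_denseSeq (Lp ℝ 2 w)).exists_dist_lt ξ
      (show 0 < ε / 2 by positivity)
    have hpos := hfP (Nat.pair i m)
    simp only [Nat.unpair_pair] at hpos
    -- Off this conull set `orbitLp` takes its default value, unrelated to the distance estimated in
    -- `hpos`.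
    rw [← measure_inter_conull (ae_iff.1 hmem)] at hpos
    refine hpos.trans_le (measure_mono fun x hx => hball ?_)
    have h1 : edist (orbitLp w f x) (d i) < ENNReal.ofReal (1 / (m + 1)) := by
      rw [edist_orbitLp hx.2]
      exact hx.1
    rw [edist_dist, ENNReal.ofReal_lt_ofReal_iff (by positivity)] at h1
    rw [Metric.mem_ball]
    have := dist_triangle (orbitLp w f x) (d i) ξ
    rw [dist_comm (d i)] at this
    linarith [show dist ξ (d i) < ε / 2 from hi]
  · exact (hmem.and hZae)
  -- Equal classes agree at some `g` where the common value is irrational; there `f` equals `f₀` at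
  -- both `g • x` and `g • y`, and `f₀` is injective.
  · intro x hx y hy hxy
    have h1 := coeFn_orbitLp hx.1
    have h2 := coeFn_orbitLp hy.1
    rw [hxy] at h1
    have h3 : ∃ᵐ g ∂w, Irrational (f (g • x)) := frequently_ae_iff.2 hx.2
    obtain ⟨g, hg, h4, h5⟩ := (h3.and_eventually (h1.and h2)).exists
    have h6 : f (g • x) = f (g • y) := h4.symm.trans h5
    have h7 : f₀ (g • x) = f₀ (g • y) := by
      rw [← hirr _ hg, h6]
      exact hirr _ (h6 ▸ hg)
    exact MulAction.injective g (hf₀i h7)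

end Universal

theorem theorem5p1 {G : Type u} [Group G] [TopologicalSpace G] [IsTopologicalGroup G]
    [T2Space G] [LocallyCompactSpace G] [SecondCountableTopology G] [NoncompactSpace G]
    [MeasurableSpace G] [BorelSpace G]
    (K : ℕ → Subgroup G) [∀ n, CompactSpace (K n)]
    (hK_open : ∀ n, IsOpen (K n : Set G)) (hK_mono : Monotone K)
    (hK_union : ⋃ n, (K n : Set G) = Set.univ)
    (p : ℕ → ℝ) (hp_pos : ∀ n, 0 < p n) (hp_sum : HasSum p 1)
    (hp_ratio : ∃ C : ℝ, 0 < C ∧ ∀ n, p n / p (n + 1) ≤ C)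
    [MeasurableSpace (Lp ℝ 2 (walkWeight (haarMixture K p) p))]
    [BorelSpace (Lp ℝ 2 (walkWeight (haarMixture K p) p))] :
    ∃ S : G →* (Lp ℝ 2 (walkWeight (haarMixture K p) p) →L[ℝ]
        Lp ℝ 2 (walkWeight (haarMixture K p) p)),
      IsRightTranslationRep (walkWeight (haarMixture K p) p) S ∧ IsUniversalRep.{v} S := by
  have := isProbabilityMeasure_walkWeight K hp_pos hp_sum
  obtain ⟨S, hS⟩ :=
    exists_isRightTranslationRep_walkWeight K hK_open hK_mono hK_union p hp_pos hp_sum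
  exact ⟨S, hS, hS.isUniversalRep hK_open hK_mono hK_union⟩
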